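/- **Setting.** Batanin trees are finite rooted planar trees; each tree $B$ has a globular set $\mathrm{Pos}(B)$ of positions (its pasting diagram), and $D_n$ denotes the linear tree, whose positions form the representable globular set on $[n]$. The categories $\mathbf{Comp}_n$ of $n$-computads, with their functors of $n$-cells $\mathrm{Cell}_n$ and $n$-spheres $\mathrm{Sph}_n$ (triples of an $(n-1)$-sphere $A$ and two $n$-cells with boundary $A$) and the free $n$-computads $\mathrm{Free}_nX$ on globular sets $X$, are defined by recursion on $n$. A $0$-computad is a set, its $0$-cells are its elements and its $0$-spheres are pairs of elements. For $n>0$ an $n$-computad $C$ consists of an $(n-1)$-computad $C_{n-1}$, a set $V_n^C$ of generators and a function $\phi_n^C:V_n^C\to\mathrm{Sph}_{n-1}(C_{n-1})$; its $n$-cells are generated inductively by $\mathrm{var}\,v$ for $v\in V_n^C$ (with boundary $\phi_n^C(v)$) and $\mathrm{coh}(B,A,\tau)$ for a tree $B$ with $\dim B\le n$, a full $(n-1)$-sphere $A$ of $\mathrm{Free}_{n-1}\mathrm{Pos}(B)$ and a homomorphism $\tau:\mathrm{Free}_n\mathrm{Pos}(B)\to C$ (with boundary the image of $A$ under $\tau$);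 an $n$-homomorphism $C\to D$ consists of an $(n-1)$-homomorphism $C_{n-1}\to D_{n-1}$ and a boundary-compatible function $V_n^C\to\mathrm{Cell}_n(D)$. An $n$-sphere $(A,a,b)$ of $\mathrm{Free}_n\mathrm{Pos}(B)$ is full if the sets of $n$-dimensional generators occurring in $a$ and in $b$ are the sets of $n$-positions of $B$ that are not targets, respectively not sources, of positions, and if $A$ is full (when $n>0$). Computads form the limit $\mathbf{Comp}$ of the categories $\mathbf{Comp}_n$; write $V_n^C$ for the set of $n$-dimensional generators of a computad $C$ ($V_0^C$ being its underlying set). The free computad functor $\mathrm{Free}:\mathbf{Glob}\to\mathbf{Comp}$ is left adjoint to the functor $\mathrm{Cell}$ of cells; $\omega\mathbf{Cat}$ is the category of algebras of the induced monad on $\mathbf{Glob}$, and $K^w:\mathbf{Comp}\to\omega\mathbf{Cat}$ is the comparison functor. Let $\mathbb D^n=\mathrm{Free}(\mathrm{Pos}(D_n))$, let $\mathbb S^{n-1}$ be the free computad on the boundary of the globular set $\mathrm{Pos}(D_n)$ (so $\mathbb S^{-1}=\emptyset$), and let $I=\{K^w\iota_n: K^w\mathbb S^{n-1}\to K^w\mathbb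 D^n\}_{n\ge 0}$ be the set of images of the inclusions. A homomorphism of $\omega\mathbf{Cat}$ is *$I$-cellular* if it lies in the closure of $I$ under coproducts, pushouts and transfinite composition. An $\omega$-category $X$ is *cofibrant* if $\emptyset\to X$ has the left lifting property against all homomorphisms that have the right lifting property against $I$. A homomorphism of computads is *generator-preserving* if it sends generators to generators, and it is an *immersion* if moreover it is injective on the generators of every dimension. **Theorem.** 1. Let $\sigma:C\to D$ be an immersion of computads. There is a sequence of computads and immersions $C\cong P^0\to P^1\to P^2\to\cdots$ with a cocone $\rho^n:P^n\to D$ such that the composite $C\cong P^0\to D$ is $\sigma$, such that $(K^w\rho^n)_n$ exhibits $K^wD$ as the colimit of the $K^wP^n$ in $\omega\mathbf{Cat}$, and such that for every $n\ge0$ the immersion $P^n\to P^{n+1}$ is bijective on generators of all dimensions $k\ne n$ and, with $V\subseteq V_n^{P^{n+1}}$ the set of $n$-dimensional generators outside its image, there is a pushout square in $\omega\mathbf{Cat}$ $$\begin{array}{ccc}\coprod_{e\in V}K^w\mathbb S^{n-1}&\xrightarrow{\ \iota_n\ }&\coprod_{e\in V}K^w\mathbb D^{n}\\ \downarrow&&\downarrow\\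 K^wP^n&\longrightarrow&K^wP^{n+1}\end{array}$$ whose right vertical map classifies the generators $e\in V$. In particular $K^w\sigma$ is the composite of an $\mathbb N$-indexed sequence of pushouts of coproducts of maps in $I$, and it is $I$-cellular. 2. Let $C$ be a computad, and let $\mathrm{Sk}_nC$ ($n\ge-1$) be its $n$-skeleton, which has the generators of $C$ of dimension at most $n$. Then $K^w\mathrm{Sk}_{-1}C$ is an initial $\omega$-category, $K^wC$ is the colimit of $K^w\mathrm{Sk}_{-1}C\to K^w\mathrm{Sk}_0C\to K^w\mathrm{Sk}_1C\to\cdots$ in $\omega\mathbf{Cat}$, and for every $n\ge0$ the map $\mathrm{Sk}_{n-1}C\to\mathrm{Sk}_nC$ is an immersion, bijective on generators of dimensions $k\ne n$, that fits in a pushout square in $\omega\mathbf{Cat}$ $$\begin{array}{ccc}\coprod_{v\in V_n^C}K^w\mathbb S^{n-1}&\xrightarrow{\ \iota_n\ }&\coprod_{v\in V_n^C}K^w\mathbb D^{n}\\ \downarrow&&\downarrow\\ K^w\mathrm{Sk}_{n-1}C&\longrightarrow&K^w\mathrm{Sk}_nC\end{array}$$ whose right vertical map classifies the generators $v\in V_n^C$.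 In particular $\emptyset\to K^wC$ is the composite of an $\mathbb N$-indexed sequence of pushouts of coproducts of maps in $I$, it is $I$-cellular, and $K^wC$ is cofibrant. -/

import Mathlib

universe u

open CategoryTheory CategoryTheory.Limits

namespace WeakOmega

/-! ## Globular sets -/

/-- A globular set: cells of every dimension with source and target maps. -/
structure Glob : Type (u + 1) where
  cell : ℕ → Type u
  src {n : ℕ} : cell (n + 1) → cell n
  tgt {n : ℕ} : cell (n + 1) → cell n
  src_src {n : ℕ} (x : cell (n + 2)) : src (src x) = src (tgt x)
  tgt_tgt {n : ℕ} (x : cell (n + 2)) : tgt (src x) = tgt (tgt x)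

namespace Glob

/-- Morphisms of globular sets. -/
@[ext]
structure Hom (X Y : Glob.{u}) : Type u where
  app (n : ℕ) : X.cell n → Y.cell n
  app_src {n : ℕ} (x : X.cell (n + 1)) : app n (X.src x) = Y.src (app (n + 1) x)
  app_tgt {n : ℕ} (x : X.cell (n + 1)) : app n (X.tgt x) = Y.tgt (app (n + 1) x)

instance : Category Glob.{u} where
  Hom := Hom
  id X := ⟨fun _ x => x, fun _ => rfl, fun _ => rfl⟩
  comp f g := ⟨fun n x => g.app n (f.app n x),
    fun x => by rw [f.app_src, g.app_src], fun x => by rw [f.app_tgt, g.app_tgt]⟩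

@[ext]
theorem hom_ext {X Y : Glob.{u}} {f g : X ⟶ Y}
    (h : ∀ n (x : X.cell n), Hom.app f n x = Hom.app g n x) : f = g :=
  Hom.ext (funext fun n => funext fun x => h n x)

@[simp]
theorem id_app (X : Glob.{u}) (n : ℕ) (x : X.cell n) : Hom.app (𝟙 X) n x = x := rfl

@[simp]
theorem comp_app {X Y Z : Glob.{u}} (f : X ⟶ Y) (g : Y ⟶ Z) (n : ℕ) (x : X.cell n) :
    Hom.app (f ≫ g) n x = Hom.app g n (Hom.app f n x) := rfl

/-- Two `n`-cells are parallel when they have common source and target (no condition if `n = 0`). -/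
def Parallel (X : Glob.{u}) : (n : ℕ) → X.cell n → X.cell n → Prop
  | 0, _, _ => True
  | _ + 1, a, b => X.src a = X.src b ∧ X.tgt a = X.tgt b

theorem parallel_src_tgt (X : Glob.{u}) :
    ∀ (n : ℕ) (x : X.cell (n + 1)), X.Parallel n (X.src x) (X.tgt x)
  | 0, _ => trivial
  | _ + 1, x => ⟨X.src_src x, X.tgt_tgt x⟩

theorem Parallel.map {X Y : Glob.{u}} (f : X ⟶ Y) : ∀ {n : ℕ} {a b : X.cell n},
    X.Parallel n a b → Y.Parallel n (Hom.app f n a) (Hom.app f n b)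
  | 0, _, _, _ => trivial
  | _ + 1, _, _, h => ⟨by rw [← Hom.app_src, ← Hom.app_src, h.1],
      by rw [← Hom.app_tgt, ← Hom.app_tgt, h.2]⟩

end Glob

/-! ## Batanin trees and their positions -/

/-- Batanin trees: rooted planar trees. -/
inductive Bat : Type
  | br : List Bat → Bat

namespace Bat

mutual
/-- The dimension (height) of a Batanin tree; see `dim_nil` and `dim_cons`. -/
def dim : Bat → ℕ
  | br L => dimList L
/-- The dimension of `br L`. -/
def dimList : List Bat → ℕ
  | [] => 0
  | B :: L => max (dim B + 1) (dimList L)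
end

theorem dim_nil : dim (br []) = 0 := rfl

theorem dim_cons (B : Bat) (L : List Bat) :
    dim (br (B :: L)) = max (dim B + 1) (dim (br L)) := rfl

/-- The globes `D_n`. -/
def globe : ℕ → Bat
  | 0 => br []
  | n + 1 => br [globe n]

end Bat

/-- The positions of a Batanin tree, indexed by their dimension. -/
inductive Pos : Bat → ℕ → Type u
  | here (B : Bat) : Pos B 0
  | inr {B : Bat} {L : List Bat} {n : ℕ} (p : Pos (Bat.br L) n) : Pos (Bat.br (B :: L)) n
  | inl {B : Bat} {L : List Bat} {n : ℕ} (q : Pos B n) : Pos (Bat.br (B :: L)) (n + 1)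

namespace Pos

/-- Auxiliary definition of the source (`b = false`) or target (`b = true`) of a position; on
positions of dimension `0` it has no meaning. -/
def bdAux (b : Bool) : {B : Bat} → {n : ℕ} → Pos.{u} B n → Pos.{u} B (n - 1)
  | _, _, here _ => here _
  | _, _, inr p => inr (bdAux b p)
  | _, _, inl (n := 0) _ => match b with
    | false => here _
    | true => inr (here _)
  | _, _, inl (n := _ + 1) q => inl (bdAux b q)

/-- Source of a position; see `src_inr`, `src_inl_zero`, `src_inl_succ`. -/
def src {B : Bat} {n : ℕ} (p : Pos.{u} B (n + 1)) : Pos.{u} B n := bdAux false p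

/-- Target of a position; see `tgt_inr`, `tgt_inl_zero`, `tgt_inl_succ`. -/
def tgt {B : Bat} {n : ℕ} (p : Pos.{u} B (n + 1)) : Pos.{u} B n := bdAux true p

section

variable {B : Bat} {L : List Bat} {n : ℕ}

theorem src_inr (p : Pos.{u} (Bat.br L) (n + 1)) : (inr (B := B) p).src = inr p.src := rfl

theorem src_inl_zero (q : Pos.{u} B 0) : (inl (L := L) q).src = here _ := rfl

theorem src_inl_succ (q : Pos.{u} B (n + 1)) : (inl (L := L) q).src = inl q.src := rfl

theorem tgt_inr (p : Pos.{u} (Bat.br L) (n + 1)) : (inr (B := B) p).tgt = inr p.tgt := rfl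

theorem tgt_inl_zero (q : Pos.{u} B 0) : (inl (L := L) q).tgt = inr (here _) := rfl

theorem tgt_inl_succ (q : Pos.{u} B (n + 1)) : (inl (L := L) q).tgt = inl q.tgt := rfl

end

theorem src_src : ∀ {B : Bat} {n : ℕ} (p : Pos.{u} B (n + 2)), p.src.src = p.tgt.src
  | _, _, inr p => congrArg inr (src_src p)
  | _, 0, inl (n := 1) _ => rfl
  | _, _ + 1, inl q => congrArg inl (src_src q)

theorem tgt_tgt : ∀ {B : Bat} {n : ℕ} (p : Pos.{u} B (n + 2)), p.src.tgt = p.tgt.tgt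
  | _, _, inr p => congrArg inr (tgt_tgt p)
  | _, 0, inl (n := 1) _ => rfl
  | _, _ + 1, inl q => congrArg inl (tgt_tgt q)

/-- The source boundary positions of dimension `n`: those which are not the target of another
position. -/
def srcBd (B : Bat) (n : ℕ) : Set (Pos.{u} B n) :=
  {p | ¬ ∃ q : Pos.{u} B (n + 1), q.tgt = p}

/-- The target boundary positions of dimension `n`: those which are not the source of another
position. -/
def tgtBd (B : Bat) (n : ℕ) : Set (Pos.{u} B n) :=
  {p | ¬ ∃ q : Pos.{u} B (n + 1), q.src = p}

end Pos

/-- The globular set of positions of a Batanin tree (its pasting diagram). -/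
@[simps]
def Bat.pos (B : Bat) : Glob.{u} where
  cell n := Pos.{u} B n
  src := Pos.src
  tgt := Pos.tgt
  src_src := Pos.src_src
  tgt_tgt := Pos.tgt_tgt

/-! ## Finite-dimensional computads

All the data that the definition of `(n+1)`-computads needs from `n`-computads are collected in
one record `Level n`. The records are built by recursion on `n` from `Level.zero` and `Level.succ`;
no other `Level` is ever used. -/

/-- The category of `n`-computads together with its generators, cells, spheres, free computads and
full spheres. -/
structure Level (n : ℕ) : Type (u + 2) where
  /-- `n`-computads and `n`-homomorphisms -/
  Comp : Type (u + 1)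
  [cat : Category.{u} Comp]
  /-- generators of dimension `n` -/
  Gen : Comp → Type u
  /-- `n`-cells, and the action of homomorphisms on them -/
  Cell : Comp → Type u
  var {C : Comp} : Gen C → Cell C
  map {C D : Comp} : (C ⟶ D) → Cell C → Cell D
  map_id {C : Comp} (c : Cell C) : map (𝟙 C) c = c
  map_comp {C D E : Comp} (σ : C ⟶ D) (τ : D ⟶ E) (c : Cell C) :
    map (σ ≫ τ) c = map τ (map σ c)
  /-- `n`-spheres, and the action of homomorphisms on them -/
  Sph : Comp → Type u
  sphMap {C D : Comp} : (C ⟶ D) → Sph C → Sph D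
  sphMap_id {C : Comp} (S : Sph C) : sphMap (𝟙 C) S = S
  sphMap_comp {C D E : Comp} (σ : C ⟶ D) (τ : D ⟶ E) (S : Sph C) :
    sphMap (σ ≫ τ) S = sphMap τ (sphMap σ S)
  /-- the two cells of a sphere -/
  pr₁ {C : Comp} : Sph C → Cell C
  pr₂ {C : Comp} : Sph C → Cell C
  pr₁_map {C D : Comp} (σ : C ⟶ D) (S : Sph C) : pr₁ (sphMap σ S) = map σ (pr₁ S)
  pr₂_map {C D : Comp} (σ : C ⟶ D) (S : Sph C) : pr₂ (sphMap σ S) = map σ (pr₂ S)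
  sph_ext {C : Comp} {S T : Sph C} : pr₁ S = pr₁ T → pr₂ S = pr₂ T → S = T
  /-- free `n`-computads on globular sets -/
  free : Glob.{u} ⥤ Comp
  freeGen {X : Glob.{u}} : X.cell n → Gen (free.obj X)
  map_freeGen {X Y : Glob.{u}} (f : X ⟶ Y) (x : X.cell n) :
    map (free.map f) (var (freeGen x)) = var (freeGen (Glob.Hom.app f n x))
  /-- the sphere given by a parallel pair of cells of a globular set -/
  posSph {X : Glob.{u}} (a b : X.cell n) : X.Parallel n a b → Sph (free.obj X)
  pr₁_posSph {X : Glob.{u}} (a b : X.cell n) (h : X.Parallel n a b) :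
    pr₁ (posSph a b h) = var (freeGen a)
  pr₂_posSph {X : Glob.{u}} (a b : X.cell n) (h : X.Parallel n a b) :
    pr₂ (posSph a b h) = var (freeGen b)
  /-- full spheres of the free computad on a Batanin tree -/
  Full (B : Bat) : Sph (free.obj B.pos) → Prop

attribute [instance] Level.cat

namespace Level

theorem sphMap_eqToHom_symm {n : ℕ} (L : Level.{u} n) {C D : L.Comp} (h : C = D) (S : L.Sph C) :
    L.sphMap (eqToHom h.symm) (L.sphMap (eqToHom h) S) = S := by
  subst h
  simp only [eqToHom_refl, L.sphMap_id]

theorem sphMap_posSph {n : ℕ} (L : Level.{u} n) {X Y : Glob.{u}} (f : X ⟶ Y) (a b : X.cell n)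
    (h : X.Parallel n a b) :
    L.sphMap (L.free.map f) (L.posSph a b h) =
      L.posSph (Glob.Hom.app f n a) (Glob.Hom.app f n b) (h.map f) := by
  apply L.sph_ext
  · rw [pr₁_map, pr₁_posSph, pr₁_posSph, map_freeGen]
  · rw [pr₂_map, pr₂_posSph, pr₂_posSph, map_freeGen]

/-- `0`-computads are sets; a `0`-cell is an element and a `0`-sphere is a pair of elements. A
sphere of a Batanin tree is full if it consists of a source and a target boundary position. -/
def zero : Level.{u} 0 where
  Comp := Type u
  Gen C := C
  Cell C := C
  var v := v
  map σ c := σ c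
  map_id _ := rfl
  map_comp _ _ _ := rfl
  Sph C := C × C
  sphMap σ S := (σ S.1, σ S.2)
  sphMap_id _ := rfl
  sphMap_comp _ _ _ := rfl
  pr₁ S := S.1
  pr₂ S := S.2
  pr₁_map _ _ := rfl
  pr₂_map _ _ := rfl
  sph_ext h₁ h₂ := Prod.ext h₁ h₂
  free := { obj X := X.cell 0, map f := ↾(Glob.Hom.app f 0) }
  freeGen x := x
  map_freeGen _ _ := rfl
  posSph a b _ := (a, b)
  pr₁_posSph _ _ _ := rfl
  pr₂_posSph _ _ _ := rfl
  Full B S := S.1 ∈ Pos.srcBd B 0 ∧ S.2 ∈ Pos.tgtBd B 0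

end Level

section Succ

variable {n : ℕ} (L : Level.{u} n)

/-- An `(n+1)`-computad: an `n`-computad, a set of generators, and a sphere for every generator. -/
structure NComp : Type (u + 1) where
  prev : L.Comp
  V : Type u
  φ : V → L.Sph prev

/-- Raw `(n+1)`-cells: generators, and coherences `coh (B, A, τ)` where the `(n+1)`-dimensional
component of `τ` takes values in raw cells. -/
inductive PreCell (C : NComp L) : Type u
  | var (v : C.V) : PreCell C
  | coh (B : Bat) (hB : B.dim ≤ n + 1) (A : L.Sph (L.free.obj B.pos)) (hA : L.Full B A)
      (τ : L.free.obj B.pos ⟶ C.prev) (τV : Pos.{u} B (n + 1) → PreCell C) : PreCell C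

/-- The free `(n+1)`-computad on a globular set. -/
def NComp.free (X : Glob.{u}) : NComp L where
  prev := L.free.obj X
  V := X.cell (n + 1)
  φ x := L.posSph (X.src x) (X.tgt x) (X.parallel_src_tgt n x)

variable {L}

namespace PreCell

variable {C D E : NComp L}

/-- The boundary sphere. -/
def ty : PreCell L C → L.Sph C.prev
  | var v => C.φ v
  | coh _ _ A _ τ _ => L.sphMap τ A

/-- A raw cell is a cell when in each of its coherences `coh (B, A, τ)` the pair `τ` is a
homomorphism out of the free computad on `B`, i.e. it is compatible with boundary spheres. -/
def IsCell : PreCell L C → Prop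
  | var _ => True
  | coh B _ _ _ τ τV => ∀ p : Pos.{u} B (n + 1), IsCell (τV p) ∧
      ty (τV p) = L.sphMap τ ((NComp.free L B.pos).φ p)

/-- The set of `(n+1)`-dimensional generators that appear in a cell. -/
def fv : PreCell L C → Set C.V
  | var v => {v}
  | coh _ _ _ _ _ τV => ⋃ p, fv (τV p)

end PreCell

namespace NComp

/-- The set of `(n+1)`-cells of an `(n+1)`-computad. -/
def Cell (C : NComp L) : Type u := {c : PreCell L C // c.IsCell}

/-- The boundary sphere of a cell. -/
def Cell.ty {C : NComp L} (c : C.Cell) : L.Sph C.prev := PreCell.ty c.1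

/-- The support of a cell. -/
def Cell.fv {C : NComp L} (c : C.Cell) : Set C.V := PreCell.fv c.1

/-- Generators as cells. -/
def Cell.var {C : NComp L} (v : C.V) : C.Cell := ⟨.var v, trivial⟩

/-- An `(n+1)`-homomorphism: an `n`-homomorphism and an assignment of cells to generators that is
compatible with boundary spheres. -/
@[ext]
structure Hom (C D : NComp L) : Type u where
  prev : C.prev ⟶ D.prev
  V : C.V → D.Cell
  ty_V (v : C.V) : (V v).ty = L.sphMap prev (C.φ v)

/-- The coherence cell `coh (B, A, τ)`. -/
def Cell.coh {C : NComp L} (B : Bat) (hB : B.dim ≤ n + 1) (A : L.Sph (L.free.obj B.pos))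
    (hA : L.Full B A) (τ : Hom (NComp.free L B.pos) C) : C.Cell :=
  ⟨.coh B hB A hA τ.prev fun p => (τ.V p).1, fun p => ⟨(τ.V p).2, τ.ty_V p⟩⟩

end NComp

namespace PreCell

variable {C D E : NComp L}

/-- The action of a homomorphism on raw cells. -/
def map (σ : NComp.Hom C D) : PreCell L C → PreCell L D
  | var v => (σ.V v).1
  | coh B hB A hA τ τV => coh B hB A hA (τ ≫ σ.prev) fun p => map σ (τV p)

theorem ty_map (σ : NComp.Hom C D) : ∀ c : PreCell L C, (c.map σ).ty = L.sphMap σ.prev c.ty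
  | var v => σ.ty_V v
  | coh _ _ _ _ _ _ => L.sphMap_comp _ _ _

theorem IsCell.map (σ : NComp.Hom C D) : ∀ {c : PreCell L C}, c.IsCell → (c.map σ).IsCell
  | .var v, _ => (σ.V v).2
  | .coh _ _ _ _ _ _, h => fun p => ⟨IsCell.map σ (h p).1,
      (ty_map σ _).trans ((congrArg _ (h p).2).trans (L.sphMap_comp _ _ _).symm)⟩

end PreCell

namespace NComp

variable {C D E : NComp L}

/-- The action of a homomorphism on cells. -/
def Cell.map (σ : Hom C D) (c : C.Cell) : D.Cell := ⟨c.1.map σ, c.2.map σ⟩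

theorem Cell.ty_map (σ : Hom C D) (c : C.Cell) : (c.map σ).ty = L.sphMap σ.prev c.ty :=
  PreCell.ty_map σ c.1

/-- Identity homomorphisms. -/
def Hom.id (C : NComp L) : Hom C C := ⟨𝟙 _, Cell.var, fun _ => (L.sphMap_id _).symm⟩

/-- Composition of homomorphisms. -/
def Hom.comp (σ : Hom C D) (τ : Hom D E) : Hom C E :=
  ⟨σ.prev ≫ τ.prev, fun v => (σ.V v).map τ, fun v => by
    rw [Cell.ty_map, σ.ty_V, L.sphMap_comp]⟩

theorem _root_.WeakOmega.PreCell.map_id : ∀ c : PreCell L C, c.map (Hom.id C) = c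
  | .var _ => rfl
  | .coh _ _ _ _ τ τV => by
    simp only [PreCell.map, Hom.id, Category.comp_id]
    congr 1
    funext p
    exact PreCell.map_id (τV p)

theorem _root_.WeakOmega.PreCell.map_comp (σ : Hom C D) (τ : Hom D E) :
    ∀ c : PreCell L C, c.map (σ.comp τ) = (c.map σ).map τ
  | .var _ => rfl
  | .coh _ _ _ _ ρ ρV => by
    simp only [PreCell.map, Hom.comp, Category.assoc]
    congr 1
    funext p
    exact PreCell.map_comp σ τ (ρV p)

theorem Cell.map_id (c : C.Cell) : c.map (Hom.id C) = c := Subtype.ext (PreCell.map_id c.1)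

theorem Cell.map_comp (σ : Hom C D) (τ : Hom D E) (c : C.Cell) :
    c.map (σ.comp τ) = (c.map σ).map τ := Subtype.ext (PreCell.map_comp σ τ c.1)

instance : Category (NComp L) where
  Hom := Hom
  id := Hom.id
  comp := Hom.comp
  id_comp _ := Hom.ext (Category.id_comp _) rfl
  comp_id _ := Hom.ext (Category.comp_id _) (funext fun _ => Cell.map_id _)
  assoc _ _ _ := Hom.ext (Category.assoc _ _ _) (funext fun _ => (Cell.map_comp _ _ _).symm)

/-- The set of `(n+1)`-spheres: triples `(A, a, b)` of an `n`-sphere `A` and two `(n+1)`-cells with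
boundary `A`. -/
@[ext]
structure Sph (C : NComp L) : Type u where
  A : L.Sph C.prev
  a : C.Cell
  b : C.Cell
  ty_a : a.ty = A
  ty_b : b.ty = A

/-- The action of a homomorphism on spheres. -/
@[simps]
def Sph.map (σ : Hom C D) (S : C.Sph) : D.Sph where
  A := L.sphMap σ.prev S.A
  a := S.a.map σ
  b := S.b.map σ
  ty_a := by rw [Cell.ty_map, S.ty_a]
  ty_b := by rw [Cell.ty_map, S.ty_b]

/-- The functor of free `(n+1)`-computads. -/
def freeFunctor (L : Level.{u} n) : Glob.{u} ⥤ NComp L where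
  obj := free L
  map {X Y} f := ⟨L.free.map f, fun x => Cell.var (Glob.Hom.app f (n + 1) x), fun x => by
    refine Eq.trans ?_ (L.sphMap_posSph f _ _ _).symm
    change L.posSph _ _ _ = _
    congr 1
    · exact (Glob.Hom.app_src f x).symm
    · exact (Glob.Hom.app_tgt f x).symm⟩
  map_id X := Hom.ext (L.free.map_id X) rfl
  map_comp f g := Hom.ext (L.free.map_comp f g) rfl

end NComp

/-- The passage from `n`-computads to `(n+1)`-computads. -/
def Level.succ (L : Level.{u} n) : Level.{u} (n + 1) where
  Comp := NComp L
  Gen C := C.V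
  Cell C := C.Cell
  var v := NComp.Cell.var v
  map σ c := c.map σ
  map_id c := c.map_id
  map_comp σ τ c := c.map_comp σ τ
  Sph C := C.Sph
  sphMap σ S := S.map σ
  sphMap_id S := NComp.Sph.ext (L.sphMap_id _) S.a.map_id S.b.map_id
  sphMap_comp σ τ S := NComp.Sph.ext (L.sphMap_comp _ _ _) (S.a.map_comp σ τ) (S.b.map_comp σ τ)
  pr₁ S := S.a
  pr₂ S := S.b
  pr₁_map _ _ := rfl
  pr₂_map _ _ := rfl
  sph_ext {C S T} h₁ h₂ := by
    refine NComp.Sph.ext ?_ h₁ h₂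
    rw [← S.ty_a, ← T.ty_a, h₁]
  free := NComp.freeFunctor L
  freeGen x := x
  map_freeGen _ _ := rfl
  posSph {X} a b h :=
    { A := L.posSph (X.src a) (X.tgt a) (X.parallel_src_tgt n a)
      a := NComp.Cell.var (C := NComp.free L X) a
      b := NComp.Cell.var (C := NComp.free L X) b
      ty_a := rfl
      ty_b := by
        change L.posSph _ _ _ = _
        congr 1
        · exact h.1.symm
        · exact h.2.symm }
  pr₁_posSph _ _ _ := rfl
  pr₂_posSph _ _ _ := rfl
  Full B S := S.a.fv = Pos.srcBd B (n + 1) ∧ S.b.fv = Pos.tgtBd B (n + 1) ∧ L.Full B S.A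

end Succ

/-- The `n`-computads with all their structure, by recursion on `n`. -/
def level : (n : ℕ) → Level.{u} n
  | 0 => Level.zero
  | n + 1 => (level n).succ

/-- The category `Comp_n` of `n`-computads. -/
abbrev CompN (n : ℕ) : Type (u + 1) := (level.{u} n).Comp

/-- The forgetful functor `Comp_{n+1} ⥤ Comp_n`. -/
def forgetN (n : ℕ) : CompN.{u} (n + 1) ⥤ CompN.{u} n where
  obj C := NComp.prev (L := level n) C
  map σ := NComp.Hom.prev (L := level n) σ
  map_id _ := rfl
  map_comp _ _ := rfl

/-- The boundary sphere of an `(n+1)`-cell. -/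
def tyN (n : ℕ) {C : CompN.{u} (n + 1)} (c : (level (n + 1)).Cell C) :
    (level n).Sph ((forgetN n).obj C) :=
  NComp.Cell.ty (L := level n) c

theorem tyN_map (n : ℕ) {C D : CompN.{u} (n + 1)} (σ : C ⟶ D) (c : (level (n + 1)).Cell C) :
    tyN n ((level (n + 1)).map σ c) = (level n).sphMap ((forgetN n).map σ) (tyN n c) :=
  NComp.Cell.ty_map (L := level n) σ c

theorem tyN_pr (n : ℕ) {C : CompN.{u} (n + 1)} (S : (level (n + 1)).Sph C) :
    tyN n ((level (n + 1)).pr₁ S) = tyN n ((level (n + 1)).pr₂ S) :=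
  (NComp.Sph.ty_a (L := level n) S).trans (NComp.Sph.ty_b (L := level n) S).symm

/-! ## Computads -/

/-- A computad: an object of the limit of the categories `Comp_n` along the forgetful functors. -/
structure Computad : Type (u + 1) where
  obj (n : ℕ) : CompN.{u} n
  compat (n : ℕ) : (forgetN n).obj (obj (n + 1)) = obj n

namespace Computad

/-- A homomorphism of computads: a compatible sequence of `n`-homomorphisms. -/
@[ext]
structure Hom (C D : Computad.{u}) : Type u where
  app (n : ℕ) : C.obj n ⟶ D.obj n
  compat (n : ℕ) : (forgetN n).map (app (n + 1)) =
    eqToHom (C.compat n) ≫ app n ≫ eqToHom (D.compat n).symm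

instance : Category Computad.{u} where
  Hom := Hom
  id C := ⟨fun n => 𝟙 (C.obj n), fun n => by simp⟩
  comp σ τ := ⟨fun n => σ.app n ≫ τ.app n, fun n => by
    simp [σ.compat, τ.compat]⟩

/-- The component of a homomorphism in `Comp_n`. -/
abbrev homApp {C D : Computad.{u}} (σ : C ⟶ D) (n : ℕ) : C.obj n ⟶ D.obj n := Hom.app σ n

theorem forget_homApp {C D : Computad.{u}} (σ : C ⟶ D) (n : ℕ) :
    (forgetN n).map (homApp σ (n + 1)) =
      eqToHom (C.compat n) ≫ homApp σ n ≫ eqToHom (D.compat n).symm := Hom.compat σ n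

@[ext]
theorem hom_ext {C D : Computad.{u}} {σ τ : C ⟶ D} (h : ∀ n, homApp σ n = homApp τ n) : σ = τ :=
  Hom.ext (funext h)

@[simp]
theorem homApp_id (C : Computad.{u}) (n : ℕ) : homApp (𝟙 C) n = 𝟙 (C.obj n) := rfl

@[simp]
theorem homApp_comp {C D E : Computad.{u}} (σ : C ⟶ D) (τ : D ⟶ E) (n : ℕ) :
    homApp (σ ≫ τ) n = homApp σ n ≫ homApp τ n := rfl

/-- The set `V_n` of generators of dimension `n`. -/
abbrev Gen (C : Computad.{u}) (n : ℕ) : Type u := (level n).Gen (C.obj n)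

/-- The set of `n`-cells. -/
abbrev Cell (C : Computad.{u}) (n : ℕ) : Type u := (level n).Cell (C.obj n)

/-- Generators as cells. -/
def var (C : Computad.{u}) {n : ℕ} (v : C.Gen n) : C.Cell n := (level n).var v

/-- The boundary sphere of an `(n+1)`-cell, as a sphere of the underlying `n`-computad. -/
def ty (C : Computad.{u}) {n : ℕ} (c : C.Cell (n + 1)) : (level n).Sph (C.obj n) :=
  (level n).sphMap (eqToHom (C.compat n)) (tyN n c)

theorem ty_pr (C : Computad.{u}) {n : ℕ} (S : (level (n + 1)).Sph (C.obj (n + 1))) :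
    C.ty ((level (n + 1)).pr₁ S) = C.ty ((level (n + 1)).pr₂ S) :=
  congrArg ((level n).sphMap (eqToHom (C.compat n))) (tyN_pr n S)

theorem ty_map {C D : Computad.{u}} (σ : C ⟶ D) {n : ℕ} (c : C.Cell (n + 1)) :
    D.ty ((level (n + 1)).map (homApp σ (n + 1)) c) =
      (level n).sphMap (homApp σ n) (C.ty c) := by
  unfold ty
  rw [tyN_map, forget_homApp, ← Level.sphMap_comp, ← Level.sphMap_comp]
  simp

/-- The globular set of cells of a computad. -/
def cells (C : Computad.{u}) : Glob.{u} where
  cell n := C.Cell n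
  src {n} c := (level n).pr₁ (C.ty c)
  tgt {n} c := (level n).pr₂ (C.ty c)
  src_src c := congrArg _ (C.ty_pr (C.ty c))
  tgt_tgt c := congrArg _ (C.ty_pr (C.ty c))

/-- The functor `Cell : Comp ⥤ Glob`. -/
def cellFunctor : Computad.{u} ⥤ Glob.{u} where
  obj := cells
  map {C _} σ :=
    { app := fun n c => (level n).map (homApp σ n) c
      app_src := fun {n} c =>
        ((level n).pr₁_map (homApp σ n) (C.ty c)).symm.trans (congrArg _ (ty_map σ c).symm)
      app_tgt := fun {n} c =>
        ((level n).pr₂_map (homApp σ n) (C.ty c)).symm.trans (congrArg _ (ty_map σ c).symm) }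
  map_id _ := Glob.hom_ext fun n c => (level n).map_id c
  map_comp σ τ := Glob.hom_ext fun n c => (level n).map_comp (homApp σ n) (homApp τ n) c

/-- The functor `Free : Glob ⥤ Comp`. -/
def freeFunctor : Glob.{u} ⥤ Computad.{u} where
  obj X := ⟨fun n => (level n).free.obj X, fun _ => rfl⟩
  map f := ⟨fun n => (level n).free.map f, fun n => by
    exact ((Category.id_comp _).trans (Category.comp_id _)).symm⟩
  map_id X := hom_ext fun n => (level n).free.map_id X
  map_comp f g := hom_ext fun n => (level n).free.map_comp f g

/-- The generators of a free computad are the cells of the globular set. -/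
def freeGen {X : Glob.{u}} {n : ℕ} (x : X.cell n) : (freeFunctor.obj X).Gen n :=
  (level n).freeGen x

theorem counit_square (C : Computad.{u}) (n : ℕ) (ε : (level n).free.obj C.cells ⟶ C.obj n)
    (hε : ∀ c : C.Cell n, (level n).map ε ((level n).var ((level n).freeGen (X := C.cells) c)) = c)
    (c : C.Cell (n + 1)) :
    tyN n c = (level n).sphMap (ε ≫ eqToHom (C.compat n).symm)
      ((level n).posSph (X := C.cells) (C.cells.src c) (C.cells.tgt c)
        (C.cells.parallel_src_tgt n c)) := by
  have key : C.ty c = (level n).sphMap ε ((level n).posSph (X := C.cells) (C.cells.src c)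
      (C.cells.tgt c) (C.cells.parallel_src_tgt n c)) := by
    apply (level n).sph_ext
    · rw [Level.pr₁_map, Level.pr₁_posSph]
      exact (hε _).symm
    · rw [Level.pr₂_map, Level.pr₂_posSph]
      exact (hε _).symm
  rw [Level.sphMap_comp, ← key]
  exact (Level.sphMap_eqToHom_symm _ _ _).symm

/-- The components of the counit of the adjunction `Free ⊣ Cell`, which sends the generator
given by a cell to that cell. -/
def counitApp (C : Computad.{u}) : (n : ℕ) →
    {ε : (level n).free.obj C.cells ⟶ C.obj n //
      ∀ c : C.cells.cell n, (level n).map ε ((level n).var ((level n).freeGen c)) = c}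
  | 0 => ⟨𝟙 _, fun _ => rfl⟩
  | n + 1 => ⟨NComp.Hom.mk (L := level n) ((counitApp C n).1 ≫ eqToHom (C.compat n).symm)
      (fun c => c) (fun c => counit_square C n (counitApp C n).1 (counitApp C n).2 c),
      fun _ => rfl⟩

/-- The component of the counit at a computad. -/
def counitHom (C : Computad.{u}) : freeFunctor.obj C.cells ⟶ C :=
  Hom.mk (fun n => (counitApp C n).1) (fun n => by
    exact (Category.id_comp ((counitApp C n).1 ≫ eqToHom (C.compat n).symm)).symm)

/-- The component of the unit at a globular set. -/
def unitHom (X : Glob.{u}) : X ⟶ (freeFunctor.obj X).cells where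
  app n x := (level n).var ((level n).freeGen x)
  app_src {n} x := by
    refine ((level n).pr₁_posSph (X.src x) (X.tgt x) (X.parallel_src_tgt n x)).symm.trans ?_
    refine congrArg _ ?_
    exact ((level n).sphMap_id _).symm
  app_tgt {n} x := by
    refine ((level n).pr₂_posSph (X.src x) (X.tgt x) (X.parallel_src_tgt n x)).symm.trans ?_
    refine congrArg _ ?_
    exact ((level n).sphMap_id _).symm

/-- Homomorphisms out of a free computad are determined by the images of the generators. -/
theorem free_hom_ext {X : Glob.{u}} {C : Computad.{u}} {σ τ : freeFunctor.obj X ⟶ C}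
    (h : ∀ n (x : X.cell n), (level n).map (homApp σ n) ((level n).var ((level n).freeGen x)) =
      (level n).map (homApp τ n) ((level n).var ((level n).freeGen x))) : σ = τ := by
  ext n
  induction n with
  | zero =>
    exact ConcreteCategory.hom_ext (C := Type u) _ _ (h 0)
  | succ n ih =>
    refine NComp.Hom.ext (L := level n) ?_ (funext fun x => h (n + 1) x)
    exact (forget_homApp σ n).trans ((by rw [ih]) : _ = _) |>.trans (forget_homApp τ n).symm

/-- The adjunction `Free ⊣ Cell`. -/
def adj : freeFunctor.{u} ⊣ cellFunctor.{u} where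
  unit := { app := unitHom, naturality := fun X Y f => Glob.hom_ext fun n x =>
    ((level n).map_freeGen f x).symm }
  counit :=
    { app := counitHom
      naturality := fun C D σ => free_hom_ext fun n c => by
        refine ((level n).map_comp _ _ _).trans (Eq.trans ?_ ((level n).map_comp _ _ _).symm)
        refine (congrArg _ ((level n).map_freeGen _ _)).trans ?_
        exact ((counitApp D n).2 _).trans
          (congrArg ((level n).map (homApp σ n)) ((counitApp C n).2 c)).symm }
  left_triangle_components X := free_hom_ext fun n x => by
    refine ((level n).map_comp _ _ _).trans ?_
    refine (congrArg _ ((level n).map_freeGen _ _)).trans ?_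
    refine ((counitApp _ n).2 _).trans ?_
    exact ((level n).map_id _).symm
  right_triangle_components C := Glob.hom_ext fun n c => (counitApp C n).2 c

end Computad

/-! ## ω-categories -/

/-- The free `ω`-category monad. -/
abbrev freeMonad : Monad Glob.{u} := Computad.adj.{u}.toMonad

/-- The category of `ω`-categories: algebras for the free `ω`-category monad. -/
abbrev OmegaCat : Type (u + 1) := freeMonad.{u}.Algebra

/-- The comparison functor `K^w : Comp ⥤ ωCat`, sending a computad to the `ω`-category it
generates. -/
abbrev K : Computad.{u} ⥤ OmegaCat.{u} := Monad.comparison Computad.adj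

/-! ## Disks, spheres and cellular maps -/

/-- The top-dimensional position of the globe `D_n`. -/
def topPos : (n : ℕ) → Pos.{u} (Bat.globe n) n
  | 0 => .here _
  | n + 1 => .inl (topPos n)

/-- The iterated source (`false`) or target (`true`) of dimension `k < n` of the top-dimensional
position of `D_n`; see `src_topPos`, `tgt_topPos`, `src_bdPos`, `tgt_bdPos`. -/
def bdPos : (n k : ℕ) → k < n → Bool → Pos.{u} (Bat.globe n) k
  | 0, _, h, _ => absurd h (Nat.not_lt_zero _)
  | _ + 1, 0, _, false => .here _
  | _ + 1, 0, _, true => .inr (.here _)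
  | n + 1, k + 1, h, b => .inl (bdPos n k (Nat.lt_of_succ_lt_succ h) b)

theorem src_topPos : ∀ n : ℕ,
    (topPos.{u} (n + 1)).src = bdPos (n + 1) n n.lt_succ_self false
  | 0 => rfl
  | n + 1 => congrArg Pos.inl (src_topPos n)

theorem tgt_topPos : ∀ n : ℕ,
    (topPos.{u} (n + 1)).tgt = bdPos (n + 1) n n.lt_succ_self true
  | 0 => rfl
  | n + 1 => congrArg Pos.inl (tgt_topPos n)

theorem src_bdPos : ∀ (n k : ℕ) (h : k + 1 < n) (b : Bool),
    (bdPos.{u} n (k + 1) h b).src = bdPos n k (Nat.lt_of_succ_lt h) false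
  | 0, _, h, _ => absurd h (Nat.not_lt_zero _)
  | _ + 1, 0, _, _ => rfl
  | n + 1, k + 1, h, b => congrArg Pos.inl (src_bdPos n k (Nat.lt_of_succ_lt_succ h) b)

theorem tgt_bdPos : ∀ (n k : ℕ) (h : k + 1 < n) (b : Bool),
    (bdPos.{u} n (k + 1) h b).tgt = bdPos n k (Nat.lt_of_succ_lt h) true
  | 0, _, h, _ => absurd h (Nat.not_lt_zero _)
  | _ + 1, 0, _, _ => rfl
  | n + 1, k + 1, h, b => congrArg Pos.inl (tgt_bdPos n k (Nat.lt_of_succ_lt_succ h) b)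

/-- The globular `(n-1)`-sphere: two cells `e_k^-` (`false`) and `e_k^+` (`true`) in every dimension
`k < n`, where `e_k^-` and `e_k^+` are the source and target of both `e_{k+1}^±`. -/
def sphereGlob (n : ℕ) : Glob.{u} where
  cell k := {_b : ULift.{u} Bool // k < n}
  src x := ⟨⟨false⟩, Nat.lt_of_succ_lt x.2⟩
  tgt x := ⟨⟨true⟩, Nat.lt_of_succ_lt x.2⟩
  src_src _ := rfl
  tgt_tgt _ := rfl

/-- The inclusion of the globular `(n-1)`-sphere as the boundary of the globe `D_n`. -/
def sphereGlobIncl (n : ℕ) : sphereGlob.{u} n ⟶ (Bat.globe n).pos where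
  app k x := bdPos n k x.2 x.1.down
  app_src {k} x := (src_bdPos n k x.2 x.1.down).symm
  app_tgt {k} x := (tgt_bdPos n k x.2 x.1.down).symm

/-- The computad `𝔻^n`. -/
abbrev disk (n : ℕ) : Computad.{u} := Computad.freeFunctor.obj (Bat.globe n).pos

/-- The top-dimensional generator of `𝔻^n`. -/
def diskTop (n : ℕ) : (disk.{u} n).Gen n :=
  Computad.freeGen (X := (Bat.globe n).pos) (topPos n)

/-- The computad `𝕊^{n-1}`; in particular `sphere 0` is the empty computad `𝕊^{-1}`. -/
abbrev sphere (n : ℕ) : Computad.{u} := Computad.freeFunctor.obj (sphereGlob n)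

/-- The inclusion `ι_n : 𝕊^{n-1} ⟶ 𝔻^n`. -/
abbrev sphereIncl (n : ℕ) : sphere.{u} n ⟶ disk n := Computad.freeFunctor.map (sphereGlobIncl n)

/-- The set `I` of the homomorphisms `K^w ι_n : K^w 𝕊^{n-1} ⟶ K^w 𝔻^n`, `n ∈ ℕ`. -/
def genCof : MorphismProperty OmegaCat.{u} :=
  MorphismProperty.ofHoms fun n : ℕ => K.map (sphereIncl.{u} n)

/-- The `I`-cellular homomorphisms: the closure of `I` under coproducts, pushouts and transfinite
composition. -/
def ICellular {X Y : OmegaCat.{u}} (f : X ⟶ Y) : Prop :=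
  ∀ W : MorphismProperty OmegaCat.{u}, genCof ≤ W →
    MorphismProperty.IsStableUnderCoproducts.{u} W → W.IsStableUnderCobaseChange →
    MorphismProperty.IsStableUnderTransfiniteComposition.{u} W → W f

/-- An `ω`-category `X` is cofibrant when the homomorphisms `∅ ⟶ X` out of initial `ω`-categories
have the left lifting property against all homomorphisms with the right lifting property
against `I`. -/
def IsCofibrant (X : OmegaCat.{u}) : Prop :=
  ∀ (E : OmegaCat.{u}) (_ : IsInitial E) (f : E ⟶ X), genCof.rlp.llp f

/-- The underlying set of `n`-cells of an `ω`-category. -/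
abbrev OmegaCat.cell (X : OmegaCat.{u}) (n : ℕ) : Type u := Glob.cell X.A n

/-- The action of a homomorphism of `ω`-categories on `n`-cells. -/
abbrev OmegaCat.app {X Y : OmegaCat.{u}} (f : X ⟶ Y) (n : ℕ) : X.cell n → Y.cell n :=
  Glob.Hom.app f.f n

/-- `AttachesCells n f χ` says that there is a pushout square
```
  ∐_{v ∈ V} K^w 𝕊^{n-1} --∐ ι_n--> ∐_{v ∈ V} K^w 𝔻^n
        |                               |
        v                               v
        X ----------------f-----------> Y
```
in `ωCat` whose right vertical map classifies the family `χ` of `n`-cells of `Y`. When `f` is a monomorphism,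
as is the case for immersions, the left vertical map is determined by commutativity: it classifies
the boundary spheres of these cells. -/
def AttachesCells (n : ℕ) {X Y : OmegaCat.{u}} (f : X ⟶ Y) {V : Type u} (χ : V → Y.cell n) :
    Prop :=
  ∃ (S : Cofan fun _ : V => K.obj (sphere.{u} n)) (D : Cofan fun _ : V => K.obj (disk.{u} n))
    (_ : IsColimit S) (_ : IsColimit D)
    (ι : S.pt ⟶ D.pt) (left : S.pt ⟶ X) (right : D.pt ⟶ Y),
    (∀ v, S.inj v ≫ ι = K.map (sphereIncl n) ≫ D.inj v) ∧
    (∀ v, OmegaCat.app (D.inj v ≫ right) n ((disk n).var (diskTop n)) = χ v) ∧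
    IsPushout ι left right f

/-! ## Generator-preserving homomorphisms, immersions and skeleta -/

namespace Computad

/-- A homomorphism is generator-preserving when it sends every generator to a generator. -/
def IsGenPreserving {C D : Computad.{u}} (σ : C ⟶ D) : Prop :=
  ∀ (n : ℕ) (v : C.Gen n), ∃ w : D.Gen n, (level n).map (homApp σ n) (C.var v) = D.var w

/-- The assignment on generators of a generator-preserving homomorphism. -/
noncomputable def IsGenPreserving.genMap {C D : Computad.{u}} {σ : C ⟶ D}
    (h : IsGenPreserving σ) (n : ℕ) (v : C.Gen n) : D.Gen n := (h n v).choose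

theorem IsGenPreserving.map_var {C D : Computad.{u}} {σ : C ⟶ D}
    (h : IsGenPreserving σ) (n : ℕ) (v : C.Gen n) :
    (level n).map (homApp σ n) (C.var v) = D.var (h.genMap n v) := (h n v).choose_spec

/-- An immersion: a generator-preserving homomorphism that is injective on generators. -/
structure IsImmersion {C D : Computad.{u}} (σ : C ⟶ D) : Prop where
  genPres : IsGenPreserving σ
  injective (n : ℕ) : Function.Injective (genPres.genMap n)

/-- An immersion that is bijective on generators of every dimension `k ≠ n`. -/
structure IsImmersionInDim (n : ℕ) {C D : Computad.{u}} (σ : C ⟶ D) : Prop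
    extends IsImmersion σ where
  bijective (k : ℕ) (hk : k ≠ n) : Function.Bijective (genPres.genMap k)

/-- The `(n+1)`-computad with no `(n+1)`-generators and a given underlying `n`-computad. -/
def skN {n : ℕ} (C : CompN.{u} n) : CompN.{u} (n + 1) :=
  NComp.mk (L := level n) C PEmpty PEmpty.elim

/-- Homomorphisms out of `skN C`. -/
def skNLift {n : ℕ} {C : CompN.{u} n} {D : CompN.{u} (n + 1)} (σ : C ⟶ (forgetN n).obj D) :
    skN C ⟶ D :=
  NComp.Hom.mk (L := level n) σ (fun v => v.elim) (fun v => v.elim)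

open Classical in
/-- The underlying `m`-computad of the `k`-th skeleton: it agrees with `C` in dimensions `m < k`
and has no generators in dimensions `m ≥ k`. -/
noncomputable def skObj (C : Computad.{u}) (k : ℕ) :
    (m : ℕ) → {S : CompN.{u} m // m < k → S = C.obj m}
  | 0 => if h : 0 < k then ⟨C.obj 0, fun _ => rfl⟩ else ⟨(PEmpty : Type u), fun h' => absurd h' h⟩
  | m + 1 => if h : m + 1 < k then ⟨C.obj (m + 1), fun _ => rfl⟩
      else ⟨skN (skObj C k m).1, fun h' => absurd h' h⟩

theorem skObj_of_lt (C : Computad.{u}) {k m : ℕ} (h : m < k) : (C.skObj k m).1 = C.obj m :=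
  (C.skObj k m).2 h

theorem skObj_zero_of_not (C : Computad.{u}) {k : ℕ} (h : ¬ 0 < k) :
    (C.skObj k 0).1 = (PEmpty : Type u) := by
  rw [skObj, dif_neg h]

theorem skObj_succ_of_not (C : Computad.{u}) {k m : ℕ} (h : ¬ m + 1 < k) :
    (C.skObj k (m + 1)).1 = skN (C.skObj k m).1 := by
  rw [skObj, dif_neg h]

/-- The skeleton `Sk_{k-1} C` spanned by the generators of dimension less than `k`. In particular
`C.sk 0` is `Sk_{-1} C`, the empty computad, and `C.sk (n + 1)` is `Sk_n C`. -/
noncomputable def sk (C : Computad.{u}) (k : ℕ) : Computad.{u} where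
  obj m := (C.skObj k m).1
  compat m := by
    by_cases h : m + 1 < k
    · rw [skObj_of_lt C h, skObj_of_lt C (Nat.lt_of_succ_lt h), C.compat]
    · rw [skObj_succ_of_not C h]
      rfl

theorem sk_obj_of_lt (C : Computad.{u}) {k m : ℕ} (h : m < k) : (C.sk k).obj m = C.obj m :=
  C.skObj_of_lt h

theorem sk_obj_zero_of_not (C : Computad.{u}) {k : ℕ} (h : ¬ 0 < k) :
    (C.sk k).obj 0 = (PEmpty : Type u) := C.skObj_zero_of_not h

theorem sk_obj_succ_of_not (C : Computad.{u}) {k m : ℕ} (h : ¬ m + 1 < k) :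
    (C.sk k).obj (m + 1) = skN ((C.sk k).obj m) := C.skObj_succ_of_not h

/-- The components of the homomorphism out of a skeleton determined by its components `f m` in
dimensions `m < k`. -/
noncomputable def skDescApp (C : Computad.{u}) (k : ℕ) (D : Computad.{u})
    (f : (m : ℕ) → m < k → (C.obj m ⟶ D.obj m)) : (m : ℕ) → ((C.sk k).obj m ⟶ D.obj m)
  | 0 =>
    if h : 0 < k then eqToHom (sk_obj_of_lt C h) ≫ f 0 h
    else eqToHom (sk_obj_zero_of_not C h) ≫
      (↾(fun v : PEmpty => v.elim) : (PEmpty : Type u) ⟶ (D.obj 0 : Type u))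
  | m + 1 =>
    if h : m + 1 < k then eqToHom (sk_obj_of_lt C h) ≫ f (m + 1) h
    else eqToHom (sk_obj_succ_of_not C h) ≫
      skNLift (skDescApp C k D f m ≫ eqToHom (D.compat m).symm)

theorem skDescApp_of_lt (C : Computad.{u}) {k : ℕ} (D : Computad.{u})
    (f : (m : ℕ) → m < k → (C.obj m ⟶ D.obj m)) {m : ℕ} (h : m < k) :
    skDescApp C k D f m = eqToHom (C.sk_obj_of_lt h) ≫ f m h := by
  cases m with
  | zero => rw [skDescApp, dif_pos h]
  | succ m => rw [skDescApp, dif_pos h]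

theorem forgetN_map_skNLift {n : ℕ} {C : CompN.{u} n} {D : CompN.{u} (n + 1)}
    (σ : C ⟶ (forgetN n).obj D) : (forgetN n).map (skNLift σ) = σ := rfl

/-- The homomorphism out of a skeleton determined by its components in dimensions `m < k`. -/
noncomputable def skDesc (C : Computad.{u}) (k : ℕ) (D : Computad.{u})
    (f : (m : ℕ) → m < k → (C.obj m ⟶ D.obj m))
    (hf : ∀ (m : ℕ) (h : m + 1 < k), (forgetN m).map (f (m + 1) h) =
      eqToHom (C.compat m) ≫ f m (Nat.lt_of_succ_lt h) ≫ eqToHom (D.compat m).symm) :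
    C.sk k ⟶ D :=
  Hom.mk (skDescApp C k D f) (fun m => by
    by_cases h : m + 1 < k
    · rw [skDescApp_of_lt C D f h, skDescApp_of_lt C D f (Nat.lt_of_succ_lt h), Functor.map_comp,
        hf m h, eqToHom_map]
      simp
    · rw [skDescApp, dif_neg h, Functor.map_comp, eqToHom_map]
      exact congrArg _ (forgetN_map_skNLift _))

theorem homApp_skDesc (C : Computad.{u}) {k : ℕ} (D : Computad.{u})
    (f : (m : ℕ) → m < k → (C.obj m ⟶ D.obj m)) (hf) {m : ℕ} (h : m < k) :
    homApp (skDesc C k D f hf) m = eqToHom (C.sk_obj_of_lt h) ≫ f m h :=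
  skDescApp_of_lt C D f h

theorem zero_hom_ext {S D : CompN.{u} 0} (h : S = (PEmpty : Type u)) (f g : S ⟶ D) : f = g := by
  subst h
  exact ConcreteCategory.hom_ext (C := Type u) _ _ (fun v => v.elim)

theorem succ_hom_ext {n : ℕ} {T : CompN.{u} n} {S D : CompN.{u} (n + 1)} (h : S = skN T)
    (f g : S ⟶ D) (hfg : (forgetN n).map f = (forgetN n).map g) : f = g := by
  subst h
  exact NComp.Hom.ext (L := level n) hfg (funext fun v => v.elim)

theorem sk_hom_ext {C D : Computad.{u}} {k : ℕ} {f g : C.sk k ⟶ D}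
    (h : ∀ m, m < k → homApp f m = homApp g m) : f = g := by
  ext m
  induction m with
  | zero =>
    by_cases hk : 0 < k
    · exact h 0 hk
    · exact zero_hom_ext (sk_obj_zero_of_not C hk) _ _
  | succ m ih =>
    by_cases hk : m + 1 < k
    · exact h _ hk
    · refine succ_hom_ext (sk_obj_succ_of_not C hk) _ _ ?_
      exact (forget_homApp f m).trans (((by rw [ih]) : _ = _).trans (forget_homApp g m).symm)

/-- The inclusion of a skeleton. -/
noncomputable def skIncl (C : Computad.{u}) (k : ℕ) : C.sk k ⟶ C :=
  skDesc C k C (fun m _ => 𝟙 (C.obj m)) (fun m _ => by simp)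

/-- The inclusion of a skeleton into a higher one. -/
noncomputable def skMap (C : Computad.{u}) {j k : ℕ} (hjk : j ≤ k) : C.sk j ⟶ C.sk k :=
  skDesc C j (C.sk k) (fun _ h => eqToHom (C.sk_obj_of_lt (lt_of_lt_of_le h hjk)).symm)
    (fun m _ => by rw [eqToHom_map]; simp)

/-- The tower of skeleta `∅ = Sk_{-1} C ⟶ Sk_0 C ⟶ Sk_1 C ⟶ ⋯` of a computad; the skeleton
`Sk_n C` sits in position `n + 1`. -/
noncomputable def skTower (C : Computad.{u}) : ℕ ⥤ Computad.{u} where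
  obj k := C.sk k
  map f := C.skMap (leOfHom f)
  map_id k := sk_hom_ext fun m h => by
    rw [skMap, homApp_skDesc _ _ _ _ h]
    simp
  map_comp {i j k} f g := sk_hom_ext fun m h => by
    rw [homApp_comp, skMap, skMap, skMap, homApp_skDesc _ _ _ _ h, homApp_skDesc _ _ _ _ h,
      homApp_skDesc _ _ _ _ (lt_of_lt_of_le h (leOfHom f))]
    simp

/-- The cocone formed by the inclusions of the skeleta. -/
noncomputable def skCocone (C : Computad.{u}) : Cocone C.skTower where
  pt := C
  ι :=
    { app := fun k => C.skIncl k
      naturality := fun {j k} f => sk_hom_ext fun m h => by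
        refine (homApp_comp _ _ m).trans ?_
        change homApp (skMap C (leOfHom f)) m ≫ homApp (skIncl C k) m =
          homApp (skIncl C j) m ≫ 𝟙 _
        rw [skMap, skIncl, skIncl, homApp_skDesc _ _ _ _ h, homApp_skDesc _ _ _ _ h,
          homApp_skDesc _ _ _ _ (lt_of_lt_of_le h (leOfHom f))]
        simp }

/-- A generator of `C` of dimension `n` as an `n`-cell of `Sk_n C`. -/
noncomputable def skVar (C : Computad.{u}) {n : ℕ} (v : C.Gen n) : (C.sk (n + 1)).Cell n :=
  (level n).map (eqToHom (C.sk_obj_of_lt n.lt_succ_self).symm) (C.var v)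

end Computad

end WeakOmega

open CategoryTheory CategoryTheory.Limits WeakOmega

-- The heart of the proof is a universal property of `K.obj C`: a homomorphism `K.obj C ⟶ X` amounts
-- to an assignment of cells of `X` to the generators of `C` that is compatible with boundaries.
-- Uniqueness is `hom_ext_kvar`, existence is `exists_hom`. Both rest on the fact that a cell is
-- either a generator or a unique coherence `coh (B, A, τ)`, which is the image under `τ` of a
-- universal coherence on the free computad of `B` (`cell_induction`, `act_cohCell_inj`). Its value
-- in `X` is therefore forced by the values at the positions of `B`, since the `ω`-category of a
-- free computad is a free algebra. Values and their boundary compatibility depend on each other, so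
-- the evaluation is first a relation `Graph`, which is then shown to be functional.
--
-- Given this, an immersion that adds generators only in dimension `n` yields a pushout
-- (`attachesCells`). A cocone prescribes values on old generators through one leg and on new ones,
-- seen as top cells of disks, through the other. The boundaries of the new generators come from the
-- spheres, where the legs agree. Likewise a tower of immersions exhausting the generators of `D`
-- has colimit `K.obj D` (`nonempty_isColimit_tower`).
--
-- The attaching and transition maps exist because immersions are injective on cells
-- (`act_injective`), so that lifting through them can be checked on generators (`exists_lift`). An
-- immersion into `D` is filtered by the subcomputads whose generators are those in its image and
-- all those of dimension less than `k`; these sets are closed under boundaries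
-- (`range_subIncl_stage`). Skeleta give the analogous tower for `∅ ⟶ C`.

namespace WeakOmega

/-! ## Cells of computads -/

namespace Computad

variable {C D E : Computad.{u}}

/-- The action of a homomorphism of computads on cells. -/
abbrev act (σ : C ⟶ D) {n : ℕ} (c : C.Cell n) : D.Cell n := (level n).map (homApp σ n) c

theorem act_id {n : ℕ} (c : C.Cell n) : act (𝟙 C) c = c := (level n).map_id c

theorem act_comp (σ : C ⟶ D) (τ : D ⟶ E) {n : ℕ} (c : C.Cell n) :
    act (σ ≫ τ) c = act τ (act σ c) := (level n).map_comp _ _ c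

/-- The source of a cell. -/
def csrc (C : Computad.{u}) {n : ℕ} (c : C.Cell (n + 1)) : C.Cell n := C.cells.src c

/-- The target of a cell. -/
def ctgt (C : Computad.{u}) {n : ℕ} (c : C.Cell (n + 1)) : C.Cell n := C.cells.tgt c

theorem act_src (σ : C ⟶ D) {n : ℕ} (c : C.Cell (n + 1)) :
    act σ (C.csrc c) = D.csrc (act σ c) :=
  Glob.Hom.app_src (cellFunctor.map σ) c

theorem act_tgt (σ : C ⟶ D) {n : ℕ} (c : C.Cell (n + 1)) :
    act σ (C.ctgt c) = D.ctgt (act σ c) :=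
  Glob.Hom.app_tgt (cellFunctor.map σ) c

theorem var_injective (n : ℕ) : Function.Injective (C.var (n := n)) := by
  cases n with
  | zero => exact fun _ _ h => h
  | succ n =>
    intro v w h
    exact PreCell.var.inj (congrArg Subtype.val h)

theorem sphMap_eqToHom_injective {n : ℕ} {A B : CompN.{u} n} (h : A = B) :
    Function.Injective ((level n).sphMap (eqToHom h)) := by
  subst h
  intro S T hST
  simpa only [eqToHom_refl, Level.sphMap_id] using hST

theorem ty_ext {n : ℕ} {a b : C.Cell (n + 1)} (h₁ : C.csrc a = C.csrc b)
    (h₂ : C.ctgt a = C.ctgt b) : C.ty a = C.ty b :=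
  (level n).sph_ext h₁ h₂

/-- Homomorphisms of computads are determined by their values on generators. -/
theorem hom_ext_var {σ τ : C ⟶ D} (h : ∀ n (v : C.Gen n), act σ (C.var v) = act τ (C.var v)) :
    σ = τ := by
  ext n
  induction n with
  | zero => exact ConcreteCategory.hom_ext (C := Type u) _ _ (h 0)
  | succ n ih =>
    refine NComp.Hom.ext (L := level n) ?_ (funext fun x => h (n + 1) x)
    exact (forget_homApp σ n).trans ((by rw [ih]) : _ = _) |>.trans (forget_homApp τ n).symm

/-- Parallel cells form a sphere. -/
theorem exists_sph : ∀ (n : ℕ) (a b : C.Cell n), C.cells.Parallel n a b →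
    ∃ S : (level n).Sph (C.obj n), (level n).pr₁ S = a ∧ (level n).pr₂ S = b
  | 0, a, b, _ => ⟨(a, b), rfl, rfl⟩
  | n + 1, a, b, h => by
    have h' : tyN n a = tyN n b := sphMap_eqToHom_injective _ (ty_ext h.1 h.2)
    exact ⟨NComp.Sph.mk (L := level n) (tyN n a) a b rfl h'.symm, rfl, rfl⟩

/-! ### Homomorphisms determined by finitely many dimensions -/

/-- A `k`-homomorphism contains its lower components: they are found by forgetting one dimension at
a time. Conjugation by `eqToHom` is needed because `compat` is only a propositional equality. -/
theorem exists_restrict : ∀ (k : ℕ) (τ : C.obj k ⟶ D.obj k),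
    ∃ f : ∀ m, m ≤ k → (C.obj m ⟶ D.obj m),
      (∀ m (h : m + 1 ≤ k), (forgetN m).map (f (m + 1) h) =
        eqToHom (C.compat m) ≫ f m (Nat.le_of_succ_le h) ≫ eqToHom (D.compat m).symm) ∧
      f k le_rfl = τ
  | 0, τ => ⟨fun m h => by
      obtain rfl : m = 0 := Nat.le_zero.mp h
      exact τ, fun m h => absurd h (Nat.not_succ_le_zero m), rfl⟩
  | k + 1, τ => by
    classical
    obtain ⟨f, hf, hk⟩ := exists_restrict k
      (eqToHom (C.compat k).symm ≫ (forgetN k).map τ ≫ eqToHom (D.compat k))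
    refine ⟨fun m h => if h' : m ≤ k then f m h' else
      (by obtain rfl : m = k + 1 := by omega
          exact τ), fun m h => ?_, ?_⟩
    · beta_reduce
      by_cases h' : m + 1 ≤ k
      · rw [dif_pos h', dif_pos (Nat.le_of_succ_le h'), hf m h']
      · obtain rfl : m = k := by omega
        rw [dif_neg h', dif_pos le_rfl, hk]
        simp
    · exact dif_neg (Nat.not_succ_le_self k)

/-- A homomorphism of `k`-computads extends to computads if the source has no generators of
dimension above `k`. -/
theorem exists_extend {k : ℕ} (τ : C.obj k ⟶ D.obj k) (hC : ∀ m, k < m → IsEmpty (C.Gen m)) :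
    ∃ σ : C ⟶ D, homApp σ k = τ := by
  classical
  obtain ⟨f, hf, rfl⟩ := exists_restrict k τ
  -- Above dimension `k` there are no generators, so the next component is the previous one with
  -- vacuous data added.
  let g : ∀ m, C.obj m ⟶ D.obj m := fun m => Nat.rec (f 0 (Nat.zero_le k))
    (fun m gm => if h : m + 1 ≤ k then f (m + 1) h else
      NComp.Hom.mk (L := level m)
        (eqToHom (C.compat m) ≫ gm ≫ eqToHom (D.compat m).symm)
        (fun v => ((hC (m + 1) (by omega)).false v).elim)
        (fun v => ((hC (m + 1) (by omega)).false v).elim)) m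
  have hg : ∀ m (h : m ≤ k), g m = f m h := fun m h => by
    cases m with
    | zero => rfl
    | succ m => exact dif_pos h
  refine ⟨Hom.mk g fun m => ?_, hg k le_rfl⟩
  by_cases h : m + 1 ≤ k
  · rw [hg _ h, hg m (Nat.le_of_succ_le h), hf m h]
  · have : g (m + 1) = NComp.Hom.mk (L := level m)
        (eqToHom (C.compat m) ≫ g m ≫ eqToHom (D.compat m).symm)
        (fun v => ((hC (m + 1) (by omega)).false v).elim)
        (fun v => ((hC (m + 1) (by omega)).false v).elim) := dif_neg h
    rw [this]
    rfl

theorem homApp_eq_of_succ {σ τ : C ⟶ D} {n : ℕ} (h : homApp σ (n + 1) = homApp τ (n + 1)) :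
    homApp σ n = homApp τ n := by
  have := congrArg (forgetN n).map h
  rw [forget_homApp, forget_homApp] at this
  exact (cancel_mono _).1 ((cancel_epi _).1 this)

theorem hom_ext_of_homApp {k : ℕ} (hC : ∀ m, k < m → IsEmpty (C.Gen m)) {σ τ : C ⟶ D}
    (h : homApp σ k = homApp τ k) : σ = τ := by
  have hle : ∀ m, m ≤ k → homApp σ m = homApp τ m := fun m hm =>
    Nat.decreasingInduction (motive := fun m _ => homApp σ m = homApp τ m)
      (fun _ _ ih => homApp_eq_of_succ ih) h hm
  refine hom_ext_var fun m v => ?_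
  by_cases hm : m ≤ k
  · exact congrArg (fun φ => (level m).map φ (C.var v)) (hle m hm)
  · exact ((hC m (by omega)).false v).elim

end Computad

/-! ### Positions and the universal coherence cells -/

theorem Pos.le_dim : ∀ {B : Bat} {n : ℕ}, Pos.{u} B n → n ≤ B.dim
  | _, _, .here _ => Nat.zero_le _
  | _, _, .inr p => (Pos.le_dim p).trans (le_max_right _ _)
  | _, _, .inl q => (Nat.succ_le_succ (Pos.le_dim q)).trans (le_max_left _ _)

theorem Pos.isEmpty_of_dim_lt {B : Bat} {n : ℕ} (h : B.dim < n) : IsEmpty (Pos.{u} B n) :=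
  ⟨fun p => absurd p.le_dim (not_le.mpr h)⟩

theorem freeGen_bijective (X : Glob.{u}) (n : ℕ) :
    Function.Bijective (Computad.freeGen (X := X) (n := n)) := by
  cases n with
  | zero => exact Function.bijective_id
  | succ n => exact Function.bijective_id

theorem isEmpty_freeGen {B : Bat} {k : ℕ} (h : B.dim ≤ k) (m : ℕ) (hm : k < m) :
    IsEmpty ((Computad.freeFunctor.obj (B.pos : Glob.{u})).Gen m) :=
  ⟨fun v => by
    obtain ⟨p, -⟩ := (freeGen_bijective _ m).2 v
    exact (Pos.isEmpty_of_dim_lt (h.trans_lt hm)).false p⟩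

namespace Computad

variable {C D : Computad.{u}}

/-- The free computad on the positions of a tree. -/
abbrev tree (B : Bat) : Computad.{u} := freeFunctor.obj B.pos

/-- A position as a cell of the free computad. -/
abbrev posVar {B : Bat} {m : ℕ} (p : Pos.{u} B m) : (tree.{u} B).Cell m :=
  (tree B).var (freeGen (X := B.pos) p)

/-- The coherence cell `coh (B, A, id)`. -/
def cohCell {n : ℕ} {B : Bat} (hB : B.dim ≤ n + 1)
    {A : (level.{u} n).Sph ((level n).free.obj B.pos)} (hA : (level n).Full B A) :
    (tree.{u} B).Cell (n + 1) :=
  NComp.Cell.coh (L := level n) B hB A hA (NComp.Hom.id _)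

/-- This links the syntax to the universal coherences: acting by `τ` on `coh (B, A, id)` gives `coh
(B, A, τ)`, up to an identity in the lower component. -/
theorem act_cohCell_val {n : ℕ} {B : Bat} (hB : B.dim ≤ n + 1)
    {A : (level.{u} n).Sph ((level n).free.obj B.pos)} (hA : (level n).Full B A)
    (τ : tree B ⟶ C) :
    (act τ (cohCell hB hA)).1 = PreCell.coh (L := level n) B hB A hA
      (NComp.Hom.prev (L := level n) (homApp τ (n + 1)))
      (fun p => (NComp.Hom.V (L := level n) (homApp τ (n + 1)) p).1) := by
  exact congrArg (fun f => PreCell.coh (L := level n) B hB A hA f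
      (fun p => (NComp.Hom.V (L := level n) (homApp τ (n + 1)) p).1)) (Category.id_comp _)

theorem act_cohCell_ne_var {n : ℕ} {B : Bat} (hB : B.dim ≤ n + 1)
    {A : (level.{u} n).Sph ((level n).free.obj B.pos)} (hA : (level n).Full B A)
    (τ : tree B ⟶ C) (v : C.Gen (n + 1)) : act τ (cohCell hB hA) ≠ C.var v := by
  intro h
  have := (act_cohCell_val hB hA τ).symm.trans (congrArg Subtype.val h)
  nomatch this

/-- Injectivity of the constructor recovers `B`, `A` and the `(n+1)`-component of `τ`. That
component determines `τ`, since `B` has no positions above dimension `n + 1`. -/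
theorem act_cohCell_inj {n : ℕ} {B B' : Bat} {hB : B.dim ≤ n + 1} {hB' : B'.dim ≤ n + 1}
    {A : (level.{u} n).Sph ((level n).free.obj B.pos)} {hA : (level n).Full B A}
    {A' : (level.{u} n).Sph ((level n).free.obj B'.pos)} {hA' : (level n).Full B' A'}
    {τ : tree B ⟶ C} {τ' : tree B' ⟶ C}
    (h : act τ (cohCell hB hA) = act τ' (cohCell hB' hA')) : B = B' ∧ HEq A A' ∧ HEq τ τ' := by
  have h' := (act_cohCell_val hB hA τ).symm.trans
    ((congrArg Subtype.val h).trans (act_cohCell_val hB' hA' τ'))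
  injection h' with h₁ h₂ h₃ h₄
  subst h₁
  refine ⟨rfl, h₂, heq_of_eq ?_⟩
  refine hom_ext_of_homApp (k := n + 1) (isEmpty_freeGen hB) ?_
  refine NComp.Hom.ext (L := level n) (eq_of_heq h₃) (funext fun p => Subtype.ext ?_)
  exact congrFun (eq_of_heq h₄) p

/-- Every cell is a generator or of the form `coh (B, A, τ)`, where the values of `τ` are
structurally smaller. -/
theorem cell_induction {P : ∀ n, C.Cell n → Prop} (var : ∀ n (v : C.Gen n), P n (C.var v))
    (coh : ∀ n (B : Bat) (hB : B.dim ≤ n + 1)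
      (A : (level.{u} n).Sph ((level n).free.obj B.pos)) (hA : (level n).Full B A)
      (τ : tree B ⟶ C), (∀ m (p : Pos.{u} B m), P m (act τ (posVar p))) →
        P (n + 1) (act τ (cohCell hB hA))) (n : ℕ) (c : C.Cell n) : P n c := by
  -- Only top-dimensional values of `τ` are subterms of a raw coherence. The inner structural
  -- induction handles those, and the outer induction on dimension handles the lower positions.
  induction n using Nat.strong_induction_on with
  | _ n ih =>
    cases n with
    | zero => exact var 0 c
    | succ n =>
      obtain ⟨c, hc⟩ := c
      induction c with
      | var v => exact var (n + 1) v
      | coh B hB A hA τ τV IH =>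
        obtain ⟨σ, hσ⟩ := exists_extend (C := tree B) (D := C) (k := n + 1)
          (NComp.Hom.mk (L := level n) τ (fun p => ⟨τV p, (hc p).1⟩) fun p => (hc p).2)
          (isEmpty_freeGen hB)
        have key : act σ (cohCell hB hA) = ⟨PreCell.coh B hB A hA τ τV, hc⟩ := by
          refine Subtype.ext ((act_cohCell_val hB hA σ).trans ?_)
          rw [hσ]
        rw [← key]
        refine coh n B hB A hA σ fun m p => ?_
        have hm : m ≤ n + 1 := p.le_dim.trans hB
        rcases hm.lt_or_eq with hm | rfl
        · exact ih m hm _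
        · have : act σ (posVar p) = ⟨τV p, (hc p).1⟩ := by
            change (level (n + 1)).map (homApp σ (n + 1)) _ = _
            rw [hσ]
            rfl
          rw [this]
          exact IH p (hc p).1

end Computad

end WeakOmega

namespace WeakOmega

/-! ## Homomorphisms from free `ω`-categories -/

open Computad

namespace OmegaCat

variable {C D : Computad.{u}} {X Y : OmegaCat.{u}} {G : Glob.{u}}

theorem hom_ext_app {f g : X ⟶ Y} (h : ∀ n x, app f n x = app g n x) : f = g :=
  Monad.Algebra.Hom.ext (Glob.hom_ext h)

theorem app_src (f : X ⟶ Y) {n : ℕ} (x : X.cell (n + 1)) :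
    app f n (Glob.src X.A x) = Glob.src Y.A (app f (n + 1) x) := Glob.Hom.app_src f.f x

theorem app_tgt (f : X ⟶ Y) {n : ℕ} (x : X.cell (n + 1)) :
    app f n (Glob.tgt X.A x) = Glob.tgt Y.A (app f (n + 1) x) := Glob.Hom.app_tgt f.f x

/-- The free `ω`-category on a globular set, with its universal property. -/
def evEquiv (G : Glob.{u}) (X : OmegaCat.{u}) :
    (K.obj (freeFunctor.obj G) ⟶ X) ≃ (G ⟶ X.A) :=
  freeMonad.adj.homEquiv G X

/-- The homomorphism out of a free `ω`-category on a globular set extending a globular map. -/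
def ev (h : G ⟶ X.A) : K.obj (freeFunctor.obj G) ⟶ X := (evEquiv G X).symm h

theorem evEquiv_app (f : K.obj (freeFunctor.obj G) ⟶ X) (n : ℕ) (x : G.cell n) :
    Glob.Hom.app (evEquiv G X f) n x = app f n ((freeFunctor.obj G).var (freeGen x)) := by
  rfl

theorem ev_var (h : G ⟶ X.A) {n : ℕ} (x : G.cell n) :
    app (ev h) n ((freeFunctor.obj G).var (freeGen x)) = Glob.Hom.app h n x := by
  rw [← evEquiv_app, ev, Equiv.apply_symm_apply]

theorem free_hom_ext {f g : K.obj (freeFunctor.obj G) ⟶ X}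
    (h : ∀ n (x : G.cell n), app f n ((freeFunctor.obj G).var (freeGen x)) =
      app g n ((freeFunctor.obj G).var (freeGen x))) : f = g :=
  (evEquiv G X).injective (Glob.hom_ext fun n x => by rw [evEquiv_app, evEquiv_app, h])

/-- The right side is one side of the algebra law for `h`, so the law can be verified by evaluating
`ev`. -/
theorem ev_f (h : G ⟶ X.A) : (ev h).f = freeMonad.map h ≫ X.a := by
  refine (congrArg Monad.Algebra.Hom.f (freeMonad.adj.homEquiv_counit (g := h))).trans ?_
  rw [Monad.adj_counit]
  rfl

theorem ev_evEquiv (f : K.obj (freeFunctor.obj G) ⟶ X) : ev (evEquiv G X f) = f :=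
  (evEquiv G X).symm_apply_apply f

/-- Homomorphisms out of `K C` are determined by their values on generators. -/
theorem hom_ext_kvar {f g : K.obj C ⟶ X}
    (h : ∀ n (v : C.Gen n), app f n (C.var v) = app g n (C.var v)) : f = g := by
  refine hom_ext_app fun n c => cell_induction (P := fun n c => app f n c = app g n c) h ?_ n c
  intro n B hB A hA τ ih
  -- The two composites agree on positions, so they agree on all cells of the tree, in particular on
  -- its universal coherence.
  have : K.map τ ≫ f = K.map τ ≫ g := free_hom_ext ih
  exact congrArg (fun φ => app φ (n + 1) (cohCell hB hA)) this

-- Evaluating the cells of a computad in an `ω`-category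

/-- The graph of the evaluation of cells of `C` in `X` determined by an assignment of cells to
generators. -/
inductive Graph (χ : ∀ n, C.Gen n → X.cell n) : ∀ n, C.Cell n → X.cell n → Prop
  | var (n : ℕ) (v : C.Gen n) : Graph χ n (C.var v) (χ n v)
  -- The map `h` has to be globular before `ev h` makes sense. A relation may demand this, whereas a
  -- recursive function would have to prove it while being defined.
  | coh (n : ℕ) (B : Bat) (hB : B.dim ≤ n + 1)
      (A : (level.{u} n).Sph ((level n).free.obj B.pos)) (hA : (level n).Full B A)
      (τ : tree B ⟶ C) (h : (B.pos : Glob.{u}) ⟶ X.A)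
      (H : ∀ m (p : Pos.{u} B m), Graph χ m (act τ (posVar p)) (Glob.Hom.app h m p)) :
      Graph χ (n + 1) (act τ (cohCell hB hA)) (app (ev h) (n + 1) (cohCell hB hA))

variable {χ : ∀ n, C.Gen n → X.cell n}

/-- Homomorphisms on both sides commute with universal coherences, so agreement with the graph
spreads from generators to all cells. Functionality of the graph is not needed, which lets this
lemma serve in proving it. -/
theorem Graph.of_hom (σ : D ⟶ C) (f : K.obj D ⟶ X)
    (h : ∀ n (v : D.Gen n), Graph χ n (act σ (D.var v)) (app f n (D.var v))) (n : ℕ)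
    (c : D.Cell n) : Graph χ n (act σ c) (app f n c) := by
  refine cell_induction (P := fun n c => Graph χ n (act σ c) (app f n c)) h ?_ n c
  intro n B hB A hA τ ih
  have e₁ : act σ (act τ (cohCell hB hA)) = act (τ ≫ σ) (cohCell hB hA) :=
    (act_comp τ σ _).symm
  have e₂ : app f (n + 1) (act τ (cohCell hB hA)) =
      app (ev (evEquiv _ _ (K.map τ ≫ f))) (n + 1) (cohCell hB hA) := by
    rw [ev_evEquiv]
    rfl
  rw [e₁, e₂]
  refine Graph.coh n B hB A hA _ _ fun m p => ?_
  have e : act (τ ≫ σ) (posVar p) = act σ (act τ (posVar p)) := act_comp τ σ _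
  rw [e]
  exact ih m p

/-- The boundary of `coh (B, A, τ)` is the image under `τ` of cells of the tree, and its value has
as boundary their images under `ev h`. Hence `Graph.of_hom` applies to the pair `τ`, `ev h`. -/
theorem Graph.src_tgt
    (hχ : ∀ n (v : C.Gen (n + 1)),
      Graph χ n (C.csrc (C.var v)) (Glob.src X.A (χ (n + 1) v)) ∧
      Graph χ n (C.ctgt (C.var v)) (Glob.tgt X.A (χ (n + 1) v)))
    {n : ℕ} {c : C.Cell (n + 1)} {x : X.cell (n + 1)} (h : Graph χ (n + 1) c x) :
    Graph χ n (C.csrc c) (Glob.src X.A x) ∧ Graph χ n (C.ctgt c) (Glob.tgt X.A x) := by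
  cases h with
  | var _ v => exact hχ n v
  | coh _ B hB A hA τ h H =>
    have key : ∀ d : (tree B).Cell n, Graph χ n (act τ d) (app (ev h) n d) :=
      Graph.of_hom τ (ev h) (fun m v => by
        obtain ⟨p, rfl⟩ := (freeGen_bijective _ m).2 v
        rw [ev_var]
        exact H m p) n
    rw [← act_src, ← act_tgt]
    exact ⟨(app_src (ev h) (n := n) (cohCell hB hA)) ▸ key _,
      (app_tgt (ev h) (n := n) (cohCell hB hA)) ▸ key _⟩

/-- Inversion of the relation. The cell is a variable with a separate equation because `C.var v` and
`act τ (cohCell _ _)` are not constructor forms that case analysis could unify. -/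
theorem Graph.eq_of_var {n : ℕ} {v : C.Gen n} {c : C.Cell n} {x : X.cell n}
    (h : Graph χ n c x) (hc : c = C.var v) : x = χ n v := by
  cases h with
  | var _ w => rw [var_injective n hc]
  | coh _ B hB A hA τ h H => exact absurd hc (act_cohCell_ne_var hB hA τ v)

theorem Graph.eq_of_coh {n : ℕ} {B : Bat} {hB : B.dim ≤ n + 1}
    {A : (level.{u} n).Sph ((level n).free.obj B.pos)} {hA : (level n).Full B A}
    {τ : tree B ⟶ C} {c : C.Cell (n + 1)} {x : X.cell (n + 1)}
    (h : Graph χ (n + 1) c x) (hc : c = act τ (cohCell hB hA)) :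
    ∃ h : (B.pos : Glob.{u}) ⟶ X.A,
      (∀ m (p : Pos.{u} B m), Graph χ m (act τ (posVar p)) (Glob.Hom.app h m p)) ∧
      x = app (ev h) (n + 1) (cohCell hB hA) := by
  cases h with
  | var _ w => exact absurd hc.symm (act_cohCell_ne_var hB hA τ w)
  | coh _ B' hB' A' hA' τ' h H =>
    obtain ⟨rfl, h₂, h₃⟩ := act_cohCell_inj hc
    cases h₂
    cases h₃
    exact ⟨h, H, rfl⟩

/-- By induction the positions of a coherence have unique values. Boundaries of values are values of
boundaries (`Graph.src_tgt`), so uniqueness makes these values a globular map, the only one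
admissible in the `coh` clause. -/
theorem Graph.existsUnique
    (hχ : ∀ n (v : C.Gen (n + 1)),
      Graph χ n (C.csrc (C.var v)) (Glob.src X.A (χ (n + 1) v)) ∧
      Graph χ n (C.ctgt (C.var v)) (Glob.tgt X.A (χ (n + 1) v)))
    (n : ℕ) (c : C.Cell n) : ∃! x, Graph χ n c x := by
  refine cell_induction (P := fun n c => ∃! x, Graph χ n c x) ?_ ?_ n c
  · exact fun n v => ⟨_, Graph.var n v, fun x hx => hx.eq_of_var rfl⟩
  · intro n B hB A hA τ ih
    choose f hf hf' using ih
    let h : (B.pos : Glob.{u}) ⟶ X.A :=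
      { app := f
        app_src := fun {m} p => (hf' m (Pos.src p) _ (by
          have := (Graph.src_tgt hχ (hf (m + 1) p)).1
          rw [← act_src] at this
          have e : posVar (Pos.src p) = (tree B).csrc (posVar p) :=
            Glob.Hom.app_src (unitHom (B.pos : Glob.{u})) p
          rwa [← e] at this)).symm
        app_tgt := fun {m} p => (hf' m (Pos.tgt p) _ (by
          have := (Graph.src_tgt hχ (hf (m + 1) p)).2
          rw [← act_tgt] at this
          have e : posVar (Pos.tgt p) = (tree B).ctgt (posVar p) :=
            Glob.Hom.app_tgt (unitHom (B.pos : Glob.{u})) p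
          rwa [← e] at this)).symm }
    refine ⟨_, Graph.coh n B hB A hA τ h hf, fun x hx => ?_⟩
    obtain ⟨h', H', rfl⟩ := hx.eq_of_coh rfl
    obtain rfl : h' = h := Glob.hom_ext fun m p => hf' m p _ (H' m p)
    rfl

/-- An assignment of cells to the generators of `C` that is compatible with boundaries extends to
a homomorphism. -/
theorem exists_hom (χ : ∀ n, C.Gen n → X.cell n)
    (hχ : ∀ n (v : C.Gen (n + 1)),
      Graph χ n (C.csrc (C.var v)) (Glob.src X.A (χ (n + 1) v)) ∧
      Graph χ n (C.ctgt (C.var v)) (Glob.tgt X.A (χ (n + 1) v))) :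
    ∃ f : K.obj C ⟶ X, ∀ n (v : C.Gen n), app f n (C.var v) = χ n v := by
  choose f hf hf' using Graph.existsUnique hχ
  let F : C.cells ⟶ X.A :=
    { app := f
      app_src := fun {n} c => (hf' _ _ _ (Graph.src_tgt hχ (hf (n + 1) c)).1).symm
      app_tgt := fun {n} c => (hf' _ _ _ (Graph.src_tgt hχ (hf (n + 1) c)).2).symm }
  refine ⟨⟨F, ?_⟩, fun n v => (hf' n _ _ (Graph.var n v)).symm⟩
  refine Glob.hom_ext fun n c => ?_
  -- The algebra law compares `F` after the counit with `ev F`. Both are values of the same cell: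
  -- they agree with the graph on generators, hence everywhere.
  have := Graph.of_hom (χ := χ) (counitHom C) (ev F) (fun m v => by
    obtain ⟨d, rfl⟩ := (freeGen_bijective _ m).2 v
    rw [ev_var]
    have e : act (counitHom C) ((freeFunctor.obj C.cells).var (freeGen d)) = d :=
      (counitApp C m).2 d
    rw [e]
    exact hf m d) n c
  exact (congrArg (fun φ => Glob.Hom.app φ n c) (ev_f F)).symm.trans (hf' n _ _ this)

end OmegaCat

end WeakOmega

namespace WeakOmega

/-! ## Immersions -/

namespace Computad

variable {C D P Q : Computad.{u}}

/-- Extension of a homomorphism of `n`-computads to dimension `n + 1`. -/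
def extendHom {n : ℕ} (l : C.obj n ⟶ D.obj n) (g : C.Gen (n + 1) → D.Cell (n + 1))
    (h : ∀ v, D.ty (g v) = (level n).sphMap l (C.ty (C.var v))) :
    C.obj (n + 1) ⟶ D.obj (n + 1) :=
  NComp.Hom.mk (L := level n) (eqToHom (C.compat n) ≫ l ≫ eqToHom (D.compat n).symm) g
    (fun v => by
      refine sphMap_eqToHom_injective (D.compat n) ((h v).trans ?_)
      unfold ty
      rw [← Level.sphMap_comp]
      refine Eq.trans ?_ ((level n).sphMap_comp _ _ _)
      have e : eqToHom (C.compat n) ≫ l =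
          (eqToHom (C.compat n) ≫ l ≫ eqToHom (D.compat n).symm) ≫ eqToHom (D.compat n) := by
        simp
      exact congrArg (fun φ => (level n).sphMap φ (tyN n (C.var v))) e)

/-- This is `cell_induction` without inductive hypotheses. Since `n` need not be a successor
syntactically, the coherence case carries an equation and a `HEq`. -/
theorem cell_cases {n : ℕ} {P : C.Cell n → Prop} (c : C.Cell n)
    (var : ∀ v : C.Gen n, c = C.var v → P c)
    (coh : ∀ (k : ℕ) (_ : n = k + 1) (B : Bat) (hB : B.dim ≤ k + 1)
      (A : (level.{u} k).Sph ((level k).free.obj B.pos)) (hA : (level k).Full B A)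
      (τ : tree B ⟶ C), HEq c (act τ (cohCell hB hA)) → P c) : P c := by
  by_contra hP
  refine cell_induction (C := C) (P := fun m d => ∀ e : n = m, e ▸ c = d → False) ?_ ?_ n c rfl rfl
  · rintro m v rfl h
    exact hP (var v h)
  · rintro m B hB A hA τ - rfl h
    exact hP (coh m rfl B hB A hA τ (heq_of_eq h))

theorem IsGenPreserving.genMap_eq {σ : C ⟶ D} (h : IsGenPreserving σ) {n : ℕ} {v : C.Gen n}
    {w : D.Gen n} (e : act σ (C.var v) = D.var w) : h.genMap n v = w :=
  var_injective n ((h.map_var n v).symm.trans e)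

/-- Immersions are injective on cells. -/
theorem IsImmersion.act_injective {σ : C ⟶ D} (h : IsImmersion σ) (n : ℕ) :
    Function.Injective (act σ (n := n)) := by
  intro c
  refine cell_induction (P := fun n c => ∀ c' : C.Cell n, act σ c = act σ c' → c = c') ?_ ?_ n c
  · intro n v c' hc
    rw [show act σ (C.var v) = D.var (h.genPres.genMap n v) from h.genPres.map_var n v] at hc
    refine cell_cases c' ?_ ?_
    · rintro w rfl
      rw [h.injective n (var_injective n (hc.trans (h.genPres.map_var n w)))]
    · rintro k rfl B hB A hA τ hc'
      cases eq_of_heq hc'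
      exact absurd ((act_comp τ σ _).trans hc.symm) (act_cohCell_ne_var hB hA _ _)
  · intro n B hB A hA τ ih c' hc
    refine cell_cases c' ?_ ?_
    · rintro w rfl
      exact absurd ((act_comp τ σ _).trans (hc.trans (h.genPres.map_var _ w)))
        (act_cohCell_ne_var hB hA _ _)
    · intro k e B' hB' A' hA' τ' hc'
      obtain rfl : n = k := Nat.succ.inj e
      cases eq_of_heq hc'
      -- Equality of the two image coherences gives `τ ≫ σ = τ' ≫ σ`; the inductive hypothesis then
      -- cancels `σ` position by position.
      obtain ⟨rfl, h₂, h₃⟩ := act_cohCell_inj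
        ((act_comp τ σ _).trans (hc.trans (act_comp τ' σ _).symm))
      cases h₂
      have : τ = τ' := hom_ext_var fun m v => by
        obtain ⟨p, rfl⟩ := (freeGen_bijective _ m).2 v
        refine ih m p _ ?_
        rw [← act_comp, eq_of_heq h₃, act_comp]
      rw [this]

theorem IsImmersion.sphMap_injective {σ : C ⟶ D} (h : IsImmersion σ) (n : ℕ) :
    Function.Injective ((level n).sphMap (homApp σ n)) := by
  intro S T hST
  refine (level n).sph_ext (h.act_injective n ?_) (h.act_injective n ?_)
  · exact ((level n).pr₁_map _ _).symm.trans ((congrArg _ hST).trans ((level n).pr₁_map _ _))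
  · exact ((level n).pr₂_map _ _).symm.trans ((congrArg _ hST).trans ((level n).pr₂_map _ _))

theorem IsImmersion.cancel {σ : P ⟶ D} (h : IsImmersion σ) {f g : C ⟶ P}
    (e : f ≫ σ = g ≫ σ) : f = g :=
  hom_ext_var fun n v => h.act_injective n (by rw [← act_comp, e, act_comp])

-- Lifting through immersions

/-- A homomorphism factors through an immersion as soon as its values on generators do. -/
theorem IsImmersion.exists_lift {ρ : P ⟶ D} (h : IsImmersion ρ) (σ : C ⟶ D)
    (hσ : ∀ n (v : C.Gen n), ∃ c : P.Cell n, act ρ c = act σ (C.var v)) :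
    ∃ l : C ⟶ P, l ≫ ρ = σ := by
  choose g hg using hσ
  -- The chosen preimages have the required boundaries because this can be tested after `ρ`, which
  -- is injective on spheres.
  have step : ∀ n (l : {l : C.obj n ⟶ P.obj n // l ≫ homApp ρ n = homApp σ n})
      (v : C.Gen (n + 1)), P.ty (g (n + 1) v) = (level n).sphMap l.1 (C.ty (C.var v)) := by
    intro n l v
    apply h.sphMap_injective n
    rw [← ty_map, ← Level.sphMap_comp, l.2, ← ty_map]
    exact congrArg D.ty (hg (n + 1) v)
  let L : ∀ n, {l : C.obj n ⟶ P.obj n // l ≫ homApp ρ n = homApp σ n} := fun n =>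
    Nat.rec ⟨(↾(g 0) : (C.obj 0 : Type u) ⟶ (P.obj 0 : Type u)),
        ConcreteCategory.hom_ext (C := Type u) _ _ (hg 0)⟩
      (fun n l => ⟨extendHom l.1 (g (n + 1)) (step n l), by
        refine NComp.Hom.ext (L := level n) ?_ (funext fun v => hg (n + 1) v)
        refine Eq.trans (b := (eqToHom (C.compat n) ≫ l.1 ≫ eqToHom (P.compat n).symm) ≫
          (forgetN n).map (homApp ρ (n + 1))) rfl (Eq.trans ?_ (forget_homApp σ n).symm)
        rw [forget_homApp]
        refine Eq.trans ?_ (congrArg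
          (fun φ => eqToHom (C.compat n) ≫ φ ≫ eqToHom (D.compat n).symm) l.2)
        simp⟩) n
  exact ⟨Hom.mk (fun n => (L n).1) (fun n => rfl), hom_ext fun n => (L n).2⟩

/-- For a coherence of dimension at most `k`, every position of its tree has dimension at most `k`.
The inductive hypothesis lifts them all, so `τ ≫ σ` factors through `ρ` and the coherence can be
formed in `P`. -/
theorem IsImmersion.exists_act_eq {ρ : P ⟶ D} (h : IsImmersion ρ) (σ : C ⟶ D) {k : ℕ}
    (hσ : ∀ m, m ≤ k → ∀ v : C.Gen m, ∃ c : P.Cell m, act ρ c = act σ (C.var v)) (m : ℕ)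
    (hm : m ≤ k) (c : C.Cell m) : ∃ d : P.Cell m, act ρ d = act σ c := by
  refine cell_induction
    (P := fun m c => m ≤ k → ∃ d : P.Cell m, act ρ d = act σ c) ?_ ?_ m c hm
  · exact fun n v hn => hσ n hn v
  · intro n B hB A hA τ ih hn
    obtain ⟨l, hl⟩ := h.exists_lift (τ ≫ σ) fun m v => by
      obtain ⟨p, rfl⟩ := (freeGen_bijective _ m).2 v
      obtain ⟨d, hd⟩ := ih m p ((Pos.le_dim p).trans (hB.trans hn))
      exact ⟨d, hd.trans (act_comp τ σ _).symm⟩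
    exact ⟨act l (cohCell hB hA), by rw [← act_comp, hl, act_comp]⟩

/-- An immersion that is surjective on generators of dimension at most `k` is surjective on cells
of dimension at most `k`. -/
theorem IsImmersion.act_surjective {ρ : P ⟶ D} (h : IsImmersion ρ) {k : ℕ}
    (hρ : ∀ m, m ≤ k → Function.Surjective (h.genPres.genMap m)) (m : ℕ) (hm : m ≤ k) :
    Function.Surjective (act ρ (n := m)) := fun c => by
  obtain ⟨d, hd⟩ := h.exists_act_eq (𝟙 D) (k := k) (fun m hm v => by
    obtain ⟨w, rfl⟩ := hρ m hm v
    exact ⟨P.var w, (h.genPres.map_var m w).trans (act_id _).symm⟩) m hm c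
  exact ⟨d, hd.trans (act_id c)⟩

/-- The first factor of an immersion through an immersion is an immersion. -/
theorem IsImmersion.of_comp {σ : C ⟶ P} {ρ : P ⟶ D} (hρ : IsImmersion ρ)
    (h : IsImmersion (σ ≫ ρ))
    (hr : ∀ n, Set.range (h.genPres.genMap n) ⊆ Set.range (hρ.genPres.genMap n)) :
    IsImmersion σ := by
  have hσ : IsGenPreserving σ := fun n v => by
    obtain ⟨w, hw⟩ := hr n ⟨v, rfl⟩
    refine ⟨w, hρ.act_injective n ?_⟩
    refine Eq.trans ?_ (hρ.genPres.map_var n w).symm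
    rw [hw, ← h.genPres.map_var n v]
    exact (act_comp σ ρ _).symm
  refine ⟨hσ, fun n v w hvw => h.injective n ?_⟩
  have : C.var v = C.var w := h.act_injective n (by
    rw [act_comp, act_comp]
    refine congrArg (act ρ) ((hσ.map_var n v).trans (Eq.trans ?_ (hσ.map_var n w).symm))
    rw [hvw])
  rw [var_injective n this]

theorem IsImmersion.genMap_comp {σ : C ⟶ P} {ρ : P ⟶ D} {τ : C ⟶ D} (e : σ ≫ ρ = τ)
    (hσ : IsImmersion σ) (hρ : IsImmersion ρ) (hτ : IsImmersion τ) (n : ℕ) (v : C.Gen n) :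
    hρ.genPres.genMap n (hσ.genPres.genMap n v) = hτ.genPres.genMap n v := by
  refine (hτ.genPres.genMap_eq ?_).symm
  rw [← e, act_comp]
  exact (congrArg (act ρ) (hσ.genPres.map_var n v)).trans (hρ.genPres.map_var n _)

/-- A factor of an immersion through an immersion is bijective on generators of dimension `k` if
both immersions reach the same generators of dimension `k`. -/
theorem IsImmersionInDim.of_range {n : ℕ} {σ : C ⟶ P} {ρ : P ⟶ D} {τ : C ⟶ D} (e : σ ≫ ρ = τ)
    (hρ : IsImmersion ρ) (hτ : IsImmersion τ)
    (hn : Set.range (hτ.genPres.genMap n) ⊆ Set.range (hρ.genPres.genMap n))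
    (hr : ∀ k, k ≠ n →
      Set.range (hτ.genPres.genMap k) = Set.range (hρ.genPres.genMap k)) :
    IsImmersionInDim n σ := by
  have hσ : IsImmersion σ := by
    subst e
    refine IsImmersion.of_comp hρ hτ fun k => ?_
    by_cases hk : k = n
    · rw [hk]
      exact hn
    · exact (hr k hk).le
  refine { hσ with bijective := fun k hk => ⟨hσ.injective k, fun w => ?_⟩ }
  obtain ⟨v, hv⟩ := (hr k hk).ge ⟨w, rfl⟩
  refine ⟨v, hρ.injective k ?_⟩
  rw [IsImmersion.genMap_comp e hσ hρ hτ, hv]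

end Computad

end WeakOmega

namespace WeakOmega

/-! ## Maps out of globes -/

namespace Glob

/-- The globular set of cells of positive dimension. -/
def shift (Y : Glob.{u}) : Glob.{u} where
  cell n := Y.cell (n + 1)
  src := Y.src
  tgt := Y.tgt
  src_src := Y.src_src
  tgt_tgt := Y.tgt_tgt

/-- The restriction of a map out of `br [B]` to the positions of `B`. -/
def Hom.unshift {B : Bat} {Y : Glob.{u}} (f : (Bat.br [B]).pos ⟶ Y) : B.pos ⟶ Y.shift where
  app n p := Hom.app f (n + 1) (Pos.inl p)
  app_src p := Hom.app_src f (n := _ + 1) (Pos.inl p)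
  app_tgt p := Hom.app_tgt f (n := _ + 1) (Pos.inl p)

/-- Two distinct `0`-positions of a globe are the source and target of a common position. Their
images are `1`-cells of `Y`, parallel by the globular identities, which makes `globeExtend`
globular. -/
theorem src_globe_eq {Y : Glob.{u}} : ∀ {n : ℕ} (f : (Bat.globe n).pos ⟶ Y.shift)
    (q : Pos.{u} (Bat.globe n) 0), Y.src (Hom.app f 0 q) = Y.src (Hom.app f 0 (Pos.here _)) ∧
      Y.tgt (Hom.app f 0 q) = Y.tgt (Hom.app f 0 (Pos.here _))
  | 0, _, .here _ => ⟨rfl, rfl⟩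
  | _ + 1, _, .here _ => ⟨rfl, rfl⟩
  | n + 1, f, .inr (.here _) => by
    have h₁ := Hom.app_src f (n := 0) (Pos.inl (Pos.here (Bat.globe n)))
    have h₂ := Hom.app_tgt f (n := 0) (Pos.inl (Pos.here (Bat.globe n)))
    have e₁ := (congrArg Y.src h₂).trans ((Y.src_src _).symm.trans (congrArg Y.src h₁).symm)
    have e₂ := (congrArg Y.tgt h₂).trans ((Y.tgt_tgt _).symm.trans (congrArg Y.tgt h₁).symm)
    exact ⟨e₁, e₂⟩

/-- The extension of a family of cells indexed by a globe by their common source and target. -/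
def globeExtend {Y : Glob.{u}} {n : ℕ} (f : (Bat.globe n).pos ⟶ Y.shift) :
    ∀ {k : ℕ}, Pos.{u} (Bat.globe (n + 1)) k → Y.cell k
  | _, .here _ => Y.src (Hom.app f 0 (Pos.here _))
  | _, .inr (.here _) => Y.tgt (Hom.app f 0 (Pos.here _))
  | _, .inl q => Hom.app f _ q

/-- Together with `globe_hom_ext`, this says that `D_n` represents `n`-cells. The induction passes
to `Y.shift`, as `D_{n+1}` is `D_n` raised by one dimension with two endpoints added. -/
theorem exists_globe_hom : ∀ (n : ℕ) (Y : Glob.{u}) (y : Y.cell n),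
    ∃ f : (Bat.globe n).pos ⟶ Y, Hom.app f n (topPos n) = y
  | 0, Y, y => ⟨{ app := fun k p => match k, p with
                    | _, .here _ => y
                  app_src := nofun
                  app_tgt := nofun }, rfl⟩
  | n + 1, Y, y => by
    obtain ⟨f, hf⟩ := exists_globe_hom n Y.shift y
    refine ⟨{ app := fun k p => globeExtend f p, app_src := ?_, app_tgt := ?_ }, hf⟩
    · intro k p
      match k, p with
      | 0, .inl q => exact (src_globe_eq f q).1.symm
      | k + 1, .inl q => exact Hom.app_src f q
    · intro k p
      match k, p with
      | 0, .inl q => exact (src_globe_eq f q).2.symm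
      | k + 1, .inl q => exact Hom.app_tgt f q

theorem globe_hom_ext : ∀ {n : ℕ} {Y : Glob.{u}} {f g : (Bat.globe n).pos ⟶ Y},
    Hom.app f n (topPos n) = Hom.app g n (topPos n) → f = g
  | 0, Y, f, g, h => Glob.hom_ext fun k p => match k, p with
    | _, .here _ => h
  | n + 1, Y, f, g, h => by
    have e : Hom.unshift f = Hom.unshift g := globe_hom_ext h
    have e' : ∀ k (q : Pos.{u} (Bat.globe n) k),
        Hom.app f (k + 1) (Pos.inl q) = Hom.app g (k + 1) (Pos.inl q) := fun k q =>
      congrArg (fun φ : (Bat.globe n).pos ⟶ Y.shift => Hom.app φ k q) e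
    refine Glob.hom_ext fun k p => ?_
    match k, p with
    | _, .inl q => exact e' _ q
    | _, .here _ =>
      exact (Hom.app_src f (n := 0) (Pos.inl (Pos.here _))).trans
        ((congrArg Y.src (e' 0 _)).trans (Hom.app_src g (n := 0) (Pos.inl (Pos.here _))).symm)
    | _, .inr (.here _) =>
      exact (Hom.app_tgt f (n := 0) (Pos.inl (Pos.here _))).trans
        ((congrArg Y.tgt (e' 0 _)).trans (Hom.app_tgt g (n := 0) (Pos.inl (Pos.here _))).symm)

/-! ### Copowers -/

/-- The coproduct of `V` copies of a globular set. -/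
def copower (V : Type u) (Y : Glob.{u}) : Glob.{u} where
  cell n := V × Y.cell n
  src x := (x.1, Y.src x.2)
  tgt x := (x.1, Y.tgt x.2)
  src_src x := by rw [Y.src_src]
  tgt_tgt x := by rw [Y.tgt_tgt]

variable {V : Type u} {Y Z : Glob.{u}}

/-- The inclusion of a copy. -/
def copowerIncl (Y : Glob.{u}) (v : V) : Y ⟶ copower V Y where
  app _ y := (v, y)
  app_src _ := rfl
  app_tgt _ := rfl

/-- The map out of a copower given by a family of maps. -/
def copowerDesc (f : V → (Y ⟶ Z)) : copower V Y ⟶ Z where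
  app n x := Hom.app (f x.1) n x.2
  app_src x := Hom.app_src (f x.1) x.2
  app_tgt x := Hom.app_tgt (f x.1) x.2

/-- The functoriality of copowers. -/
def copowerMap (V : Type u) (f : Y ⟶ Z) : copower V Y ⟶ copower V Z where
  app n x := (x.1, Hom.app f n x.2)
  app_src x := congrArg (Prod.mk x.1) (Hom.app_src f x.2)
  app_tgt x := congrArg (Prod.mk x.1) (Hom.app_tgt f x.2)

theorem copowerIncl_map (f : Y ⟶ Z) (v : V) :
    copowerIncl Y v ≫ copowerMap V f = f ≫ copowerIncl Z v := rfl

end Glob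

-- Free computads and coproducts of free `ω`-categories

namespace Computad

variable {C : Computad.{u}} {G H : Glob.{u}}

/-- A cell of a globular set as a generator cell of the free computad. -/
abbrev freeVar {n : ℕ} (x : G.cell n) : (freeFunctor.obj G).Cell n :=
  (freeFunctor.obj G).var (freeGen x)

/-- The homomorphism out of a free computad extending a map of globular sets. -/
def freeLift (f : G ⟶ C.cells) : freeFunctor.obj G ⟶ C := freeFunctor.map f ≫ counitHom C

theorem act_freeMap (f : G ⟶ H) {n : ℕ} (x : G.cell n) :
    act (freeFunctor.map f) (freeVar x) = freeVar (Glob.Hom.app f n x) :=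
  (level n).map_freeGen f x

theorem act_freeLift (f : G ⟶ C.cells) {n : ℕ} (x : G.cell n) :
    act (freeLift f) (freeVar x) = Glob.Hom.app f n x := by
  rw [freeLift, act_comp, act_freeMap]
  exact (counitApp C n).2 _

theorem csrc_freeVar {n : ℕ} (x : G.cell (n + 1)) :
    (freeFunctor.obj G).csrc (freeVar x) = freeVar (G.src x) :=
  (Glob.Hom.app_src (unitHom G) x).symm

theorem ctgt_freeVar {n : ℕ} (x : G.cell (n + 1)) :
    (freeFunctor.obj G).ctgt (freeVar x) = freeVar (G.tgt x) :=
  (Glob.Hom.app_tgt (unitHom G) x).symm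

end Computad

open Computad OmegaCat

/-- The coproduct of `V` copies of a free `ω`-category. -/
def freeCofan (V : Type u) (G : Glob.{u}) :
    Cofan fun _ : V => K.obj (freeFunctor.obj G) :=
  Cofan.mk (K.obj (freeFunctor.obj (Glob.copower V G)))
    fun v => K.map (freeFunctor.map (Glob.copowerIncl G v))

theorem app_freeCofan_inj {V : Type u} {G : Glob.{u}} (v : V) {n : ℕ} (x : G.cell n) :
    app ((freeCofan V G).inj v) n (freeVar x) = freeVar (G := Glob.copower V G) (v, x) :=
  act_freeMap (Glob.copowerIncl G v) x

/-- `freeCofan` is a coproduct. -/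
def isColimitFreeCofan (V : Type u) (G : Glob.{u}) : IsColimit (freeCofan V G) :=
  Cofan.IsColimit.mk _
    (fun s => ev (Glob.copowerDesc fun v => evEquiv G s.pt (s.inj v)))
    (fun s v => OmegaCat.free_hom_ext fun n x =>
      (congrArg (app (ev (Glob.copowerDesc fun v => evEquiv G s.pt (s.inj v))) n)
        (app_freeCofan_inj v x)).trans (ev_var (G := Glob.copower V G) _ (v, x)))
    (fun s m hm => OmegaCat.free_hom_ext fun n x =>
      (congrArg (app m n) (app_freeCofan_inj x.1 x.2)).symm.trans
        ((congrArg (fun φ : K.obj (freeFunctor.obj G) ⟶ s.pt => app φ n (freeVar x.2))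
          (hm x.1)).trans (ev_var (G := Glob.copower V G)
            (Glob.copowerDesc fun v => evEquiv G s.pt (s.inj v)) x).symm))

/-! ## Attaching cells along immersions -/

/-- Generators of `Q` are the disjoint union of those of `P` and the family `g`, so prescriptions on
both pieces glue. The companion `gen_cases` is the matching case analysis. -/
theorem Computad.IsImmersionInDim.exists_values {n : ℕ} {P Q : Computad.{u}} {σ : P ⟶ Q}
    (h : IsImmersionInDim n σ) {V : Type u} {g : V → Q.Gen n} (hg : Function.Injective g)
    (hr : ∀ w, w ∉ Set.range (h.genPres.genMap n) ↔ w ∈ Set.range g) {T : ℕ → Type u}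
    (t : ∀ k, P.Gen k → T k) (a : V → T n) :
    ∃ χ : ∀ k, Q.Gen k → T k, (∀ k w, χ k (h.genPres.genMap k w) = t k w) ∧
      ∀ v, χ n (g v) = a v := by
  have : ∀ k (w : Q.Gen k), ∃ x : T k, (∀ w', h.genPres.genMap k w' = w → x = t k w') ∧
      ∀ v (e : n = k), e ▸ g v = w → x = e ▸ a v := by
    intro k w
    by_cases hk : k = n
    · subst hk
      by_cases hw : w ∈ Set.range (h.genPres.genMap k)
      · obtain ⟨w', rfl⟩ := hw
        refine ⟨t k w', fun w'' hw' => by rw [h.injective k hw'], fun v _ hv => ?_⟩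
        exact absurd ⟨w', rfl⟩ ((hr _).2 ⟨v, hv⟩)
      · obtain ⟨v, rfl⟩ := (hr w).1 hw
        exact ⟨a v, fun w' hw' => absurd ⟨w', hw'⟩ hw, fun v' _ hv => by rw [hg hv]⟩
    · obtain ⟨w', rfl⟩ := (h.bijective k hk).2 w
      exact ⟨t k w', fun w'' hw' => by rw [h.injective k hw'],
        fun v e => absurd e.symm hk⟩
  choose χ hχ hχ' using this
  exact ⟨χ, fun k w => hχ k _ w rfl, fun v => hχ' n _ v rfl rfl⟩

theorem Computad.IsImmersionInDim.gen_cases {n : ℕ} {P Q : Computad.{u}} {σ : P ⟶ Q}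
    (h : IsImmersionInDim n σ) {V : Type u} {g : V → Q.Gen n}
    (hr : ∀ w, w ∉ Set.range (h.genPres.genMap n) ↔ w ∈ Set.range g)
    {p : ∀ k, Q.Gen k → Prop} (h₁ : ∀ k w, p k (h.genPres.genMap k w)) (h₂ : ∀ v, p n (g v))
    (k : ℕ) (w : Q.Gen k) : p k w := by
  by_cases hw : w ∈ Set.range (h.genPres.genMap k)
  · obtain ⟨w', rfl⟩ := hw
    exact h₁ k w'
  · by_cases hk : k = n
    · subst hk
      obtain ⟨v, rfl⟩ := (hr w).1 hw
      exact h₂ v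
    · exact absurd ((h.bijective k hk).2 w) hw

/-- A cocone on the square assigns a cell to each generator of `Q`: old ones through `P`, new ones
through the disks. Its commutativity on spheres is exactly boundary compatibility at the new
generators, so `exists_hom` gives the induced map. -/
theorem Computad.IsImmersionInDim.attachesCells {n : ℕ} {P Q : Computad.{u}} {σ : P ⟶ Q}
    (h : IsImmersionInDim n σ) {V : Type u} {g : V → Q.Gen n} (hg : Function.Injective g)
    (hr : ∀ w, w ∉ Set.range (h.genPres.genMap n) ↔ w ∈ Set.range g) :
    AttachesCells n (K.map σ) (fun v => Q.var (g v)) := by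
  choose y hy using fun v => Glob.exists_globe_hom n Q.cells (Q.var (g v))
  let R : freeFunctor.obj (Glob.copower V (Bat.globe n).pos) ⟶ Q :=
    freeLift (Glob.copowerDesc y)
  let ι := freeFunctor.map (Glob.copowerMap V (sphereGlobIncl.{u} n))
  have hR : ∀ v, act R (freeVar (G := Glob.copower V (Bat.globe n).pos) (v, topPos n)) =
      Q.var (g v) := fun v => (act_freeLift _ _).trans (hy v)
  have hι : ∀ v k (x : (sphereGlob.{u} n).cell k),
      act ι (freeVar (G := Glob.copower V (sphereGlob.{u} n)) (v, x)) =
        freeVar (G := Glob.copower V (Bat.globe n).pos) (v, bdPos n k x.2 x.1.down) :=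
    fun v k x => act_freeMap _ _
  -- The attaching map exists because sphere generators have dimension `m < n`, and up to dimension
  -- `m` the immersion is bijective on generators, hence surjective on cells.
  obtain ⟨l, hl⟩ := h.exists_lift (ι ≫ R) (fun m v => by
    obtain ⟨⟨v, x⟩, rfl⟩ := (freeGen_bijective _ m).2 v
    exact h.act_surjective (k := m)
      (fun k hk => (h.bijective k (hk.trans_lt x.2).ne).2) m le_rfl _)
  have hvar : ∀ k w, act σ (P.var w) = Q.var (h.genPres.genMap k w) :=
    fun k w => h.genPres.map_var k w
  refine ⟨freeCofan V _, freeCofan V _, isColimitFreeCofan V _, isColimitFreeCofan V _,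
    K.map ι, K.map l, K.map R, fun v => ?_, fun v => ?_, ?_⟩
  · have e : freeFunctor.map (Glob.copowerIncl _ v) ≫ ι =
        sphereIncl n ≫ freeFunctor.map (Glob.copowerIncl _ v) := by
      rw [← freeFunctor.map_comp, ← freeFunctor.map_comp, Glob.copowerIncl_map]
    exact (K.map_comp _ _).symm.trans ((congrArg K.map e).trans (K.map_comp _ _))
  · exact (congrArg (act R) (app_freeCofan_inj v (topPos n))).trans (hR v)
  refine ⟨⟨(K.map_comp _ _).symm.trans ((congrArg K.map hl.symm).trans (K.map_comp _ _))⟩, ⟨?_⟩⟩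
  have key : ∀ s : PushoutCocone (K.map ι) (K.map l),
      ∃ f : K.obj Q ⟶ s.pt, K.map R ≫ f = s.inl ∧ K.map σ ≫ f = s.inr := by
    intro s
    obtain ⟨χ, hχ, hχ'⟩ := h.exists_values hg hr (T := OmegaCat.cell s.pt)
      (fun k w => app s.inr k (P.var w))
      (fun v => app s.inl n (freeVar (G := Glob.copower V (Bat.globe n).pos) (v, topPos n)))
    have hσ : ∀ k (c : P.Cell k), Graph χ k (act σ c) (app s.inr k c) :=
      Graph.of_hom σ s.inr fun k w => by
        rw [hvar, ← hχ]
        exact Graph.var _ _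
    -- On cells coming from the spheres, the disk leg equals the leg through `P`, which is already
    -- known to follow the graph.
    have hs : ∀ k (d : (freeFunctor.obj (Glob.copower V (sphereGlob.{u} n))).Cell k),
        Graph χ k (act R (act ι d)) (app s.inl k (act ι d)) := fun k d => by
      have e₁ : act R (act ι d) = act σ (act l d) := by rw [← act_comp, ← act_comp, hl]
      have e₂ : app s.inl k (act ι d) = app s.inr k (act l d) :=
        congrArg (fun φ : K.obj (freeFunctor.obj (Glob.copower V (sphereGlob.{u} n))) ⟶ s.pt =>
          app φ k d) s.condition
      rw [e₁, e₂]
      exact hσ k _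
    obtain ⟨f, hf⟩ := exists_hom (C := Q) χ (fun k w => by
      -- The case of a new generator replaces the dimension by `n`, so `k + 1` is detached from it
      -- through the equation `e`.
      refine h.gen_cases hr (p := fun m w => ∀ e : m = k + 1,
        Graph χ k (Q.csrc (Q.var (e ▸ w))) (Glob.src s.pt.A (χ (k + 1) (e ▸ w))) ∧
        Graph χ k (Q.ctgt (Q.var (e ▸ w))) (Glob.tgt s.pt.A (χ (k + 1) (e ▸ w))))
        ?_ ?_ (k + 1) w rfl
      · rintro m w rfl
        dsimp only
        rw [← hvar, ← act_src, ← act_tgt, hχ]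
        exact ⟨(app_src s.inr (P.var w)) ▸ hσ k _, (app_tgt s.inr (P.var w)) ▸ hσ k _⟩
      · rintro v rfl
        dsimp only
        rw [← hR, ← act_src, ← act_tgt, hχ']
        -- The source and target of the top cell of each disk are generators of its boundary sphere,
        -- which brings `hs` into play.
        have e₁ : csrc _ (freeVar (G := Glob.copower V (Bat.globe (k + 1)).pos)
            (v, topPos (k + 1))) = act ι (freeVar (G := Glob.copower V (sphereGlob.{u} (k + 1)))
              (v, ⟨⟨false⟩, k.lt_succ_self⟩)) := by
          refine (csrc_freeVar (G := Glob.copower V (Bat.globe (k + 1)).pos) _).trans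
            (Eq.trans ?_ (hι v k _).symm)
          exact congrArg (fun q => freeVar (G := Glob.copower V (Bat.globe (k + 1)).pos) (v, q))
            (src_topPos k)
        have e₂ : ctgt _ (freeVar (G := Glob.copower V (Bat.globe (k + 1)).pos)
            (v, topPos (k + 1))) = act ι (freeVar (G := Glob.copower V (sphereGlob.{u} (k + 1)))
              (v, ⟨⟨true⟩, k.lt_succ_self⟩)) := by
          refine (ctgt_freeVar (G := Glob.copower V (Bat.globe (k + 1)).pos) _).trans
            (Eq.trans ?_ (hι v k _).symm)
          exact congrArg (fun q => freeVar (G := Glob.copower V (Bat.globe (k + 1)).pos) (v, q))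
            (tgt_topPos k)
        refine ⟨(app_src s.inl (n := k) _) ▸ ?_, (app_tgt s.inl (n := k) _) ▸ ?_⟩
        · have := hs k (freeVar (G := Glob.copower V (sphereGlob.{u} (k + 1)))
            (v, ⟨⟨false⟩, k.lt_succ_self⟩))
          rw [← e₁] at this
          exact this
        · have := hs k (freeVar (G := Glob.copower V (sphereGlob.{u} (k + 1)))
            (v, ⟨⟨true⟩, k.lt_succ_self⟩))
          rw [← e₂] at this
          exact this)
    refine ⟨f, ?_, hom_ext_kvar fun k w => ?_⟩
    -- A homomorphism out of a coproduct of disks is determined by the top cell of each summand.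
    · refine (isColimitFreeCofan V _).hom_ext fun ⟨v⟩ => (evEquiv _ _).injective ?_
      refine Glob.globe_hom_ext ?_
      have e : app (K.map R ≫ f) n (app ((freeCofan V _).inj v) n
          (freeVar (G := (Bat.globe n).pos) (topPos n))) =
          app s.inl n (app ((freeCofan V _).inj v) n
            (freeVar (G := (Bat.globe n).pos) (topPos n))) := by
        have e₀ := app_freeCofan_inj (G := (Bat.globe n).pos) v (topPos n)
        exact (congrArg (app (K.map R ≫ f) n) e₀).trans ((congrArg (app f n) (hR v)).trans
          ((hf n _).trans ((hχ' v).trans (congrArg (app s.inl n) e₀).symm)))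
      exact e
    · exact (congrArg (app f k) (hvar k w)).trans ((hf k _).trans (hχ k w))
  choose f hf hf' using key
  refine PushoutCocone.IsColimit.mk _ f hf hf' fun s m hm hm' => hom_ext_kvar fun k w => ?_
  refine h.gen_cases hr (p := fun k w => app m k (Q.var w) = app (f s) k (Q.var w)) ?_ ?_ k w
  · intro k w
    rw [← hvar]
    exact congrArg (fun φ => app φ k (P.var w)) (hm'.trans (hf' s).symm)
  · intro v
    rw [← hR]
    exact congrArg (fun φ => app φ n (freeVar (G := Glob.copower V (Bat.globe n).pos)
      (v, topPos n))) (hm.trans (hf s).symm)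

/-! ## Towers of immersions -/

/-- Each generator of `D` already lives in some stage, where a cocone gives it a value. Injectivity
of immersions on cells makes the value independent of the stage, and its boundary can be computed in
that stage too. -/
theorem nonempty_isColimit_tower {D : Computad.{u}} (P : ℕ ⥤ Computad.{u})
    (ρ : P ⟶ (Functor.const ℕ).obj D) (hρ : ∀ k, IsImmersion (ρ.app k))
    (hs : ∀ m k, m < k → Function.Surjective ((hρ k).genPres.genMap m)) :
    Nonempty (IsColimit (K.mapCocone { pt := D, ι := ρ })) := by
  have hvar : ∀ k m (w : (P.obj k).Gen m),
      act (ρ.app k) ((P.obj k).var w) = D.var ((hρ k).genPres.genMap m w) :=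
    fun k m w => (hρ k).genPres.map_var m w
  have key : ∀ s : Cocone (P ⋙ K), ∃ f : K.obj D ⟶ s.pt, ∀ k, K.map (ρ.app k) ≫ f = s.ι.app k := by
    intro s
    -- Stage `m + 1`, not `m`, is the first at which all `m`-generators are guaranteed.
    choose pre hpre using fun m => hs m (m + 1) m.lt_succ_self
    let χ : ∀ m, D.Gen m → OmegaCat.cell s.pt m := fun m v =>
      app (s.ι.app (m + 1)) m ((P.obj (m + 1)).var (pre m v))
    have hχ : ∀ k m (w : (P.obj k).Gen m),
        χ m ((hρ k).genPres.genMap m w) = app (s.ι.app k) m ((P.obj k).var w) := by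
      intro k m w
      have nat : ∀ i j (hij : i ≤ j) (c : (P.obj i).Cell m),
          app (s.ι.app i) m c = app (s.ι.app j) m (act (P.map (homOfLE hij)) c) :=
        fun i j hij c => (congrArg (fun φ => app φ m c) (s.w (homOfLE hij))).symm
      have nat' : ∀ i j (hij : i ≤ j) (c : (P.obj i).Cell m),
          act (ρ.app j) (act (P.map (homOfLE hij)) c) = act (ρ.app i) c := fun i j hij c => by
        rw [← act_comp]
        exact congrArg (fun φ => act φ c)
          ((ρ.naturality (homOfLE hij)).trans (Category.comp_id _))
      -- Both representatives are moved to a common stage, where they coincide because they have the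
      -- same image in `D`.
      refine (nat _ (max k (m + 1)) (le_max_right _ _) _).trans
        (Eq.trans ?_ (nat _ (max k (m + 1)) (le_max_left _ _) _).symm)
      refine congrArg _ ((hρ _).act_injective m ?_)
      rw [nat', nat', hvar, hvar, hpre]
    have hG : ∀ k m (c : (P.obj k).Cell m),
        Graph χ m (act (ρ.app k) c) (app (s.ι.app k) m c) := fun k m c =>
      Graph.of_hom (ρ.app k) (s.ι.app k) (fun m w => by
        rw [hvar, ← hχ]
        exact Graph.var _ _) m c
    obtain ⟨f, hf⟩ := exists_hom (C := D) χ (fun m v => by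
      obtain ⟨w, rfl⟩ := hs (m + 1) (m + 2) (m + 1).lt_succ_self v
      rw [← hvar, hχ]
      have h₁ := hG (m + 2) m ((P.obj (m + 2)).csrc ((P.obj (m + 2)).var w))
      have h₂ := hG (m + 2) m ((P.obj (m + 2)).ctgt ((P.obj (m + 2)).var w))
      rw [act_src] at h₁
      rw [act_tgt] at h₂
      exact ⟨(app_src (s.ι.app (m + 2)) ((P.obj (m + 2)).var w)) ▸ h₁,
        (app_tgt (s.ι.app (m + 2)) ((P.obj (m + 2)).var w)) ▸ h₂⟩)
    refine ⟨f, fun k => hom_ext_kvar fun m w => ?_⟩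
    refine Eq.trans ?_ (hχ k m w)
    rw [← hf, ← hvar]
    rfl
  choose f hf using key
  refine ⟨⟨f, hf, fun s m hm => hom_ext_kvar fun k v => ?_⟩⟩
  obtain ⟨w, rfl⟩ := hs k (k + 1) k.lt_succ_self v
  rw [← hvar]
  exact congrArg (fun φ => app φ k ((P.obj (k + 1)).var w)) ((hm _).trans (hf s _).symm)

end WeakOmega

namespace WeakOmega

/-! ## Subcomputads and the filtration of an immersion -/

namespace Computad

variable {C D P : Computad.{u}}

/-- The underlying `m`-computad of the largest subcomputad of `D` with generators in `S`, and its
inclusion. -/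
noncomputable def subObj (D : Computad.{u}) (S : ∀ m, Set (D.Gen m)) :
    (m : ℕ) → (P : CompN.{u} m) × (P ⟶ D.obj m)
  | 0 => ⟨({v : D.Gen 0 // v ∈ S 0} : Type u), ↾(fun v => v.1)⟩
  | m + 1 =>
    ⟨NComp.mk (L := level m) (subObj D S m).1
        -- A generator is kept only if its boundary lifts to what has been built so far. For `S`
        -- closed under boundaries nothing is lost (`range_genMap_subIncl`).
        {v : D.Gen (m + 1) // v ∈ S (m + 1) ∧
          ∃ A, (level m).sphMap (subObj D S m).2 A = D.ty (D.var v)} (fun v => v.2.2.choose),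
      NComp.Hom.mk (L := level m) ((subObj D S m).2 ≫ eqToHom (D.compat m).symm)
        (fun v => D.var v.1) (fun v => by
          refine sphMap_eqToHom_injective (D.compat m) (v.2.2.choose_spec.symm.trans ?_)
          refine Eq.trans ?_ ((level m).sphMap_comp _ _ _)
          have e : (subObj D S m).2 =
              ((subObj D S m).2 ≫ eqToHom (D.compat m).symm) ≫ eqToHom (D.compat m) := by
            simp
          exact congrArg (fun φ => (level m).sphMap φ v.2.2.choose) e)⟩

/-- The largest subcomputad of `D` with generators in `S`. -/
noncomputable def sub (D : Computad.{u}) (S : ∀ m, Set (D.Gen m)) : Computad.{u} where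
  obj m := (subObj D S m).1
  compat _ := rfl

/-- The inclusion of a subcomputad. -/
noncomputable def subIncl (D : Computad.{u}) (S : ∀ m, Set (D.Gen m)) : sub D S ⟶ D :=
  Hom.mk (fun m => (subObj D S m).2) fun m => by
    refine Eq.trans ?_ (Category.id_comp ((subObj D S m).2 ≫ eqToHom (D.compat m).symm)).symm
    rfl

theorem exists_subGen (D : Computad.{u}) (S : ∀ m, Set (D.Gen m)) (m : ℕ) :
    ∃ f : (sub D S).Gen m → D.Gen m, Function.Injective f ∧
      (∀ v, act (subIncl D S) ((sub D S).var v) = D.var (f v)) ∧ Set.range f ⊆ S m ∧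
      ∀ v ∈ S m, (∀ k (e : m = k + 1),
        ∃ A, (level k).sphMap (homApp (subIncl D S) k) A = D.ty (e ▸ D.var v)) →
          v ∈ Set.range f := by
  cases m with
  | zero =>
    exact ⟨Subtype.val, Subtype.val_injective, fun _ => rfl, fun _ ⟨v, hv⟩ => hv ▸ v.2,
      fun v hv _ => ⟨⟨v, hv⟩, rfl⟩⟩
  | succ m =>
    exact ⟨Subtype.val, Subtype.val_injective, fun _ => rfl, fun _ ⟨v, hv⟩ => hv ▸ v.2.1,
      fun v hv h => ⟨⟨v, hv, h m rfl⟩, rfl⟩⟩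

theorem isImmersion_of_genMap {σ : C ⟶ D} (f : ∀ m, C.Gen m → D.Gen m)
    (hf : ∀ m v, act σ (C.var v) = D.var (f m v)) (hi : ∀ m, Function.Injective (f m)) :
    ∃ h : IsImmersion σ, ∀ m, h.genPres.genMap m = f m := by
  have h : IsGenPreserving σ := fun m v => ⟨f m v, hf m v⟩
  have e : ∀ m, h.genMap m = f m := fun m => funext fun v => h.genMap_eq (hf m v)
  exact ⟨⟨h, fun m => by rw [e]; exact hi m⟩, e⟩

theorem isImmersion_subIncl (D : Computad.{u}) (S : ∀ m, Set (D.Gen m)) :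
    IsImmersion (subIncl D S) := by
  choose f hf using exists_subGen D S
  exact (isImmersion_of_genMap f (fun m => (hf m).2.1) (fun m => (hf m).1)).1

/-- Lifts of the source and target are parallel because `ρ` is injective on cells, so they form a
sphere. -/
theorem IsImmersion.exists_sphMap_eq {ρ : P ⟶ D} (h : IsImmersion ρ) {n : ℕ} {c : D.Cell (n + 1)}
    (h₁ : ∃ a, act ρ a = D.csrc c) (h₂ : ∃ b, act ρ b = D.ctgt c) :
    ∃ A, (level n).sphMap (homApp ρ n) A = D.ty c := by
  obtain ⟨a, ha⟩ := h₁
  obtain ⟨b, hb⟩ := h₂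
  have hpar : P.cells.Parallel n a b := by
    have := D.cells.parallel_src_tgt n c
    cases n with
    | zero => trivial
    | succ n =>
      constructor
      · apply h.act_injective n
        refine (act_src ρ a).trans (Eq.trans ?_ (act_src ρ b).symm)
        rw [ha, hb]
        exact this.1
      · apply h.act_injective n
        refine (act_tgt ρ a).trans (Eq.trans ?_ (act_tgt ρ b).symm)
        rw [ha, hb]
        exact this.2
  obtain ⟨A, rfl, rfl⟩ := exists_sph n a b hpar
  exact ⟨A, (level n).sph_ext (((level n).pr₁_map _ _).trans ha)
    (((level n).pr₂_map _ _).trans hb)⟩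

/-- If `S` is closed under boundaries, then the subcomputad has all the generators in `S`. -/
theorem range_genMap_subIncl (S : ∀ m, Set (D.Gen m))
    (hS : ∀ m, (∀ k, k ≤ m → Set.range ((isImmersion_subIncl D S).genPres.genMap k) = S k) →
      ∀ v ∈ S (m + 1), (∃ a, act (subIncl D S) a = D.csrc (D.var v)) ∧
        ∃ b, act (subIncl D S) b = D.ctgt (D.var v)) (m : ℕ) :
    Set.range ((isImmersion_subIncl D S).genPres.genMap m) = S m := by
  induction m using Nat.strong_induction_on with
  | _ m ih =>
    obtain ⟨f, -, hf, h₁, h₂⟩ := exists_subGen D S m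
    have e : (isImmersion_subIncl D S).genPres.genMap m = f :=
      funext fun v => (isImmersion_subIncl D S).genPres.genMap_eq (hf v)
    rw [e]
    refine h₁.antisymm fun v hv => h₂ v hv ?_
    rintro k rfl
    obtain ⟨ha, hb⟩ := hS k (fun j hj => ih j (Nat.lt_succ_of_le hj)) v hv
    exact (isImmersion_subIncl D S).exists_sphMap_eq ha hb

theorem IsImmersion.exists_lift_of_range {ρ : P ⟶ D} (hρ : IsImmersion ρ) {τ : C ⟶ D}
    (hτ : IsImmersion τ)
    (h : ∀ m, Set.range (hτ.genPres.genMap m) ⊆ Set.range (hρ.genPres.genMap m)) :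
    ∃ l : C ⟶ P, l ≫ ρ = τ :=
  hρ.exists_lift τ fun m v => by
    obtain ⟨w, hw⟩ := h m ⟨v, rfl⟩
    refine ⟨P.var w, (hρ.genPres.map_var m w).trans ?_⟩
    rw [hw]
    exact (hτ.genPres.map_var m v).symm

/-- The generators of the `k`-th stage of the filtration of an immersion. -/
def IsImmersion.stage {σ : C ⟶ D} (h : IsImmersion σ) (k m : ℕ) : Set (D.Gen m) :=
  {w | m < k ∨ w ∈ Set.range (h.genPres.genMap m)}

/-- Each stage is closed under boundaries. Below dimension `k` all lower generators, hence all lower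
cells, are present. The boundary of a generator in the image of `σ` is the image of cells of `C`,
which `exists_act_eq` lifts. -/
theorem IsImmersion.range_subIncl_stage {σ : C ⟶ D} (h : IsImmersion σ) (k m : ℕ) :
    Set.range ((isImmersion_subIncl D (h.stage k)).genPres.genMap m) = h.stage k m := by
  refine range_genMap_subIncl _ (fun m ih v hv => ?_) m
  have hρ := isImmersion_subIncl D (h.stage k)
  rcases hv with hv | ⟨w, rfl⟩
  · have := hρ.act_surjective (k := m) (fun j hj w =>
      (ih j hj).ge (show w ∈ h.stage k j from Or.inl (by omega))) m le_rfl
    exact ⟨this _, this _⟩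
  · have := hρ.exists_act_eq σ (k := m) (fun j hj w => by
      obtain ⟨x, hx⟩ := (ih j hj).ge
        (show h.genPres.genMap j w ∈ h.stage k j from Or.inr ⟨w, rfl⟩)
      refine ⟨_, (hρ.genPres.map_var j x).trans ?_⟩
      rw [hx]
      exact (h.genPres.map_var j w).symm) m le_rfl
    have e : D.var (h.genPres.genMap (m + 1) w) = act σ (C.var w) :=
      (h.genPres.map_var (m + 1) w).symm
    rw [e, ← act_src, ← act_tgt]
    exact ⟨this _, this _⟩

/-- Inclusions of generator sets induce the transition maps, and cancellation of immersions gives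
functoriality. At `k = 0` the dimension clause is void, so stage `0` has exactly the generators in
the image of `σ` and is isomorphic to `C`. -/
theorem IsImmersion.exists_filtration {σ : C ⟶ D} (h : IsImmersion σ) :
    ∃ (P : ℕ ⥤ Computad.{u}) (ρ : P ⟶ (Functor.const ℕ).obj D)
      (hρ : ∀ k, IsImmersion (ρ.app k)),
      (∀ k m, Set.range ((hρ k).genPres.genMap m) =
        {w | m < k ∨ w ∈ Set.range (h.genPres.genMap m)}) ∧
      ∃ e : C ≅ P.obj 0, e.hom ≫ ρ.app 0 = σ := by
  have hρ := fun k => isImmersion_subIncl D (h.stage k)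
  have hr := h.range_subIncl_stage
  have hl : ∀ i j, i ≤ j →
      ∃ l : sub D (h.stage i) ⟶ sub D (h.stage j), l ≫ subIncl D (h.stage j) =
        subIncl D (h.stage i) := fun i j hij =>
    (hρ j).exists_lift_of_range (hρ i) fun m => by
      rw [hr, hr]
      exact fun w hw => hw.imp (fun hw => hw.trans_le hij) id
  choose l hl using hl
  let P : ℕ ⥤ Computad.{u} :=
    { obj := fun k => sub D (h.stage k)
      map := fun f => l _ _ (leOfHom f)
      map_id := fun k => (hρ k).cancel (by rw [hl, Category.id_comp])
      map_comp := fun f g => (hρ _).cancel (by rw [Category.assoc, hl, hl, hl]) }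
  let ρ : P ⟶ (Functor.const ℕ).obj D :=
    { app := fun k => subIncl D (h.stage k)
      naturality := fun i j f => (hl i j (leOfHom f)).trans (Category.comp_id _).symm }
  obtain ⟨f, hf⟩ := (hρ 0).exists_lift_of_range h fun m => by
    rw [hr]
    exact fun w hw => Or.inr hw
  obtain ⟨g, hg⟩ := h.exists_lift_of_range (hρ 0) fun m => by
    rw [hr]
    exact fun w hw => hw.resolve_left (Nat.not_lt_zero m)
  exact ⟨P, ρ, hρ, hr, ⟨f, g, h.cancel (by rw [Category.assoc, hg, hf, Category.id_comp]),
    (hρ 0).cancel (by rw [Category.assoc, hf, hg, Category.id_comp])⟩, hf⟩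

/-! ## Skeleta -/

theorem exists_gen_eqToHom {m : ℕ} {A B : CompN.{u} m} (e : A = B) :
    ∃ f : (level m).Gen A → (level m).Gen B, Function.Bijective f ∧
      ∀ v, (level m).map (eqToHom e) ((level m).var v) = (level m).var (f v) := by
  subst e
  exact ⟨id, Function.bijective_id, fun v => (level m).map_id _⟩

theorem isEmpty_gen_sk (C : Computad.{u}) {k m : ℕ} (h : ¬ m < k) : IsEmpty ((C.sk k).Gen m) := by
  cases m with
  | zero =>
    obtain ⟨f, -, -⟩ := exists_gen_eqToHom (sk_obj_zero_of_not C h)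
    exact ⟨fun v => PEmpty.elim (f v)⟩
  | succ m =>
    obtain ⟨f, -, -⟩ := exists_gen_eqToHom (sk_obj_succ_of_not C h)
    exact ⟨fun v => PEmpty.elim (f v)⟩

/-- This subjects the skeletal tower to the same range comparisons as the filtration of an
immersion. -/
theorem exists_isImmersion_skIncl (C : Computad.{u}) (k : ℕ) :
    ∃ h : IsImmersion (C.skIncl k), ∀ m, Set.range (h.genPres.genMap m) = {_v | m < k} := by
  classical
  have : ∀ m, ∃ f : (C.sk k).Gen m → C.Gen m, Function.Injective f ∧
      Set.range f = {_v | m < k} ∧ ∀ v, act (C.skIncl k) ((C.sk k).var v) = C.var (f v) := by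
    intro m
    by_cases h : m < k
    · obtain ⟨f, hf, hf'⟩ := exists_gen_eqToHom (sk_obj_of_lt C h)
      refine ⟨f, hf.1, ?_, fun v => ?_⟩
      · rw [hf.2.range_eq]
        exact (Set.eq_univ_of_forall fun _ => h).symm
      · refine Eq.trans ?_ (hf' v)
        unfold act
        rw [skIncl, homApp_skDesc _ _ _ _ h, Category.comp_id]
        rfl
    · have := isEmpty_gen_sk C h
      exact ⟨isEmptyElim, fun v => isEmptyElim v, (Set.range_eq_empty _).trans
        (Set.eq_empty_of_forall_notMem fun _ => h).symm, fun v => isEmptyElim v⟩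
  choose f h₁ h₂ h₃ using this
  obtain ⟨h, e⟩ := isImmersion_of_genMap f h₃ h₁
  exact ⟨h, fun m => by rw [e, h₂]⟩

theorem exists_skVar_eq (C : Computad.{u}) (n : ℕ) :
    ∃ g : C.Gen n → (C.sk (n + 1)).Gen n, Function.Bijective g ∧
      ∀ v, C.skVar v = (C.sk (n + 1)).var (g v) :=
  exists_gen_eqToHom (C.sk_obj_of_lt n.lt_succ_self).symm

theorem skMap_skIncl (C : Computad.{u}) {j k : ℕ} (h : j ≤ k) :
    C.skMap h ≫ C.skIncl k = C.skIncl j :=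
  (C.skCocone.ι.naturality (homOfLE h)).trans (Category.comp_id _)

theorem isImmersionInDim_skMap (C : Computad.{u}) (n : ℕ) :
    IsImmersionInDim n (C.skMap n.le_succ) := by
  obtain ⟨h₁, e₁⟩ := exists_isImmersion_skIncl C n
  obtain ⟨h₂, e₂⟩ := exists_isImmersion_skIncl C (n + 1)
  refine IsImmersionInDim.of_range (skMap_skIncl C n.le_succ) h₂ h₁ ?_ fun k hk => ?_
  · rw [e₁, e₂]
    exact fun _ h => Nat.lt_succ_of_lt h
  · rw [e₁, e₂]
    exact Set.ext fun _ => ⟨fun h => Nat.lt_succ_of_lt h,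
      fun h => lt_of_le_of_ne (Nat.le_of_lt_succ h) hk⟩

/-- `C.sk n` has no `n`-generators, so every `n`-generator of `C.sk (n + 1)` is new; `g` reindexes
them by `C.Gen n`. -/
theorem attachesCells_skMap (C : Computad.{u}) (n : ℕ) :
    AttachesCells n (K.map (C.skMap n.le_succ)) (fun v : C.Gen n => C.skVar v) := by
  obtain ⟨g, hg, e⟩ := exists_skVar_eq C n
  have : (fun v : C.Gen n => C.skVar v) = fun v => (C.sk (n + 1)).var (g v) := funext e
  rw [this]
  have := isEmpty_gen_sk C (lt_irrefl n)
  refine (isImmersionInDim_skMap C n).attachesCells hg.1 fun w => ⟨fun _ => hg.2 w, ?_⟩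
  rintro - ⟨v, -⟩
  exact isEmptyElim v

/-- A computad without generators generates an initial `ω`-category. -/
theorem nonempty_isInitial_K (h : ∀ n, IsEmpty (C.Gen n)) : Nonempty (IsInitial (K.obj C)) := by
  have : ∀ X : OmegaCat.{u}, Nonempty (Unique (K.obj C ⟶ X)) := fun X => by
    obtain ⟨f, -⟩ := OmegaCat.exists_hom (C := C) (X := X) (fun n v => ((h n).false v).elim)
      (fun n v => ((h (n + 1)).false v).elim)
    exact ⟨⟨⟨f⟩, fun g => OmegaCat.hom_ext_kvar fun n v => ((h n).false v).elim⟩⟩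
  have := fun X => Classical.choice (this X)
  exact ⟨IsInitial.ofUnique _⟩

theorem nonempty_isColimit_skCocone (C : Computad.{u}) :
    Nonempty (IsColimit (K.mapCocone C.skCocone)) := by
  choose h e using exists_isImmersion_skIncl C
  exact nonempty_isColimit_tower C.skTower C.skCocone.ι h fun m k hk w => (e k m).ge hk

end Computad

/-! ## Cellular homomorphisms -/

theorem AttachesCells.mem_pushouts {n : ℕ} {X Y : OmegaCat.{u}} {f : X ⟶ Y} {V : Type u}
    {χ : V → Y.cell n} (h : AttachesCells n f χ) : genCof.{u}.coproducts.{u}.pushouts f := by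
  obtain ⟨S, D, hS, hD, ι, left, right, hι, -, hp⟩ := h
  refine MorphismProperty.pushouts_mk _ hp.flip
    (MorphismProperty.colimitsOfShape_le_coproducts _ V _ ?_)
  refine MorphismProperty.colimitsOfShape.mk' _ _ S D hS hD
    (Discrete.natTrans fun _ => K.map (sphereIncl n)) (fun _ => MorphismProperty.ofHoms.mk n) ι fun ⟨v⟩ => hι v

theorem iCellular_of_transfiniteCompositionsOfShape {X Y : OmegaCat.{u}} {f : X ⟶ Y}
    (h : genCof.{u}.coproducts.{u}.pushouts.transfiniteCompositionsOfShape ℕ f) :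
    ICellular f := by
  intro W hW _ _ _
  -- The shape `ℕ` lives in universe `0`, while stability of `W` is assumed in universe `u`.
  have := MorphismProperty.IsStableUnderTransfiniteComposition.shrink₀.{u} W
  refine MorphismProperty.transfiniteCompositionsOfShape_le W ℕ _
    (MorphismProperty.transfiniteCompositionsOfShape_monotone ℕ ?_ _ h)
  exact (MorphismProperty.pushouts_le_iff).2 ((MorphismProperty.coproducts_le_iff).2 hW)

/-- A class defined by a left lifting property has all the closure properties in `ICellular`, and
this one contains `I`. -/
theorem ICellular.llp_rlp {X Y : OmegaCat.{u}} {f : X ⟶ Y} (h : ICellular f) :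
    genCof.{u}.rlp.llp f :=
  h _ (MorphismProperty.le_llp_rlp _) inferInstance inferInstance inferInstance

theorem transfiniteCompositionsOfShape_of_tower {D : Computad.{u}} (P : ℕ ⥤ Computad.{u})
    (ρ : P ⟶ (Functor.const ℕ).obj D)
    (hρ : Nonempty (IsColimit (K.mapCocone { pt := D, ι := ρ })))
    (hP : ∀ n : ℕ, genCof.{u}.coproducts.{u}.pushouts (K.map (P.map (homOfLE n.le_succ))))
    {X : OmegaCat.{u}} (e : K.obj (P.obj 0) ≅ X) {f : X ⟶ K.obj D}
    (he : e.inv ≫ K.map (ρ.app 0) = f) :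
    genCof.{u}.coproducts.{u}.pushouts.transfiniteCompositionsOfShape ℕ f :=
  ⟨{ F := P ⋙ K
     isoBot := e
     incl := (K.mapCocone { pt := D, ι := ρ }).ι
     isColimit := hρ.some
     fac := he
     map_mem := fun n _ => hP n }⟩

end WeakOmega

-- Assembly of the two filtrations

theorem mainTheorem6 :
    -- every immersion is a sequential composite of immersions that add generators in a single
    -- dimension; these are pushouts of coproducts of sphere-disk inclusions
    (∀ {C D : Computad.{u}} (σ : C ⟶ D), Computad.IsImmersion σ →
      (∃ (P : ℕ ⥤ Computad.{u}) (ρ : P ⟶ (Functor.const ℕ).obj D) (e : C ≅ P.obj 0),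
        e.hom ≫ ρ.app 0 = σ ∧
        (∀ n : ℕ, ∃ h : Computad.IsImmersionInDim n (P.map (homOfLE n.le_succ)),
          AttachesCells n (K.map (P.map (homOfLE n.le_succ)))
            (fun v : {w : (P.obj (n + 1)).Gen n // w ∉ Set.range (h.genPres.genMap n)} =>
              (P.obj (n + 1)).var v.1)) ∧
        Nonempty (IsColimit (K.mapCocone { pt := D, ι := ρ }))) ∧
      genCof.{u}.coproducts.{u}.pushouts.transfiniteCompositionsOfShape ℕ (K.map σ) ∧
      ICellular (K.map σ)) ∧
    -- the skeletal filtration of a free ω-category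
    (∀ C : Computad.{u},
      Nonempty (IsColimit (K.mapCocone C.skCocone)) ∧
      Nonempty (IsInitial (K.obj (C.sk 0))) ∧
      (∀ n : ℕ, Computad.IsImmersionInDim n (C.skMap n.le_succ) ∧
        AttachesCells n (K.map (C.skMap n.le_succ)) (fun v : C.Gen n => C.skVar v)) ∧
      (∀ (E : OmegaCat.{u}) (_ : IsInitial E) (f : E ⟶ K.obj C),
        genCof.{u}.coproducts.{u}.pushouts.transfiniteCompositionsOfShape ℕ f ∧ ICellular f) ∧
      IsCofibrant (K.obj C)) := by
  refine ⟨fun {C D} σ hσ => ?_, fun C => ?_⟩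
  · obtain ⟨P, ρ, hρ, hr, e, he⟩ := hσ.exists_filtration
    have hcolim : Nonempty (IsColimit (K.mapCocone { pt := D, ι := ρ })) :=
      nonempty_isColimit_tower P ρ hρ fun m k hk w => (hr k m).ge (Or.inl hk)
    have hdim : ∀ n : ℕ, Computad.IsImmersionInDim n (P.map (homOfLE n.le_succ)) := fun n => by
      refine Computad.IsImmersionInDim.of_range
        ((ρ.naturality (homOfLE n.le_succ)).trans (Category.comp_id _))
        (hρ (n + 1)) (hρ n) ?_ fun k hk => ?_
      · rw [hr, hr]
        exact fun w hw => hw.imp Nat.lt_succ_of_lt id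
      · rw [hr, hr]
        -- The conditions `k < n` and `k < n + 1` differ only at `k = n`.
        exact Set.ext fun w => or_congr_left
          ⟨Nat.lt_succ_of_lt, fun h => lt_of_le_of_ne (Nat.le_of_lt_succ h) hk⟩
    have hatt : ∀ n : ℕ, AttachesCells n (K.map (P.map (homOfLE n.le_succ)))
        (fun v : {w : (P.obj (n + 1)).Gen n // w ∉ Set.range ((hdim n).genPres.genMap n)} =>
          (P.obj (n + 1)).var v.1) := fun n =>
      (hdim n).attachesCells Subtype.val_injective fun w =>
        ⟨fun hw => ⟨⟨w, hw⟩, rfl⟩, fun ⟨v, hv⟩ => hv ▸ v.2⟩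
    have htrans : genCof.{u}.coproducts.{u}.pushouts.transfiniteCompositionsOfShape ℕ
        (K.map σ) :=
      transfiniteCompositionsOfShape_of_tower P ρ hcolim (fun n => (hatt n).mem_pushouts)
        (K.mapIso e.symm) ((K.map_comp _ _).symm.trans (congrArg K.map he))
    exact ⟨⟨P, ρ, e, he, fun n => ⟨hdim n, hatt n⟩, hcolim⟩, htrans,
      iCellular_of_transfiniteCompositionsOfShape htrans⟩
  · have hcolim := C.nonempty_isColimit_skCocone
    obtain ⟨hinit⟩ := Computad.nonempty_isInitial_K (C := C.sk 0)
      fun n => C.isEmpty_gen_sk (Nat.not_lt_zero n)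
    have htrans : ∀ (E : OmegaCat.{u}) (_ : IsInitial E) (f : E ⟶ K.obj C),
        genCof.{u}.coproducts.{u}.pushouts.transfiniteCompositionsOfShape ℕ f := fun E hE f =>
      transfiniteCompositionsOfShape_of_tower C.skTower C.skCocone.ι hcolim
        (fun n => (C.attachesCells_skMap n).mem_pushouts) (hinit.uniqueUpToIso hE)
        (hE.hom_ext _ _)
    exact ⟨hcolim, ⟨hinit⟩,
      fun n => ⟨C.isImmersionInDim_skMap n, C.attachesCells_skMap n⟩,
      fun E hE f => ⟨htrans E hE f, iCellular_of_transfiniteCompositionsOfShape (htrans E hE f)⟩,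
      fun E hE f => (iCellular_of_transfiniteCompositionsOfShape (htrans E hE f)).llp_rlp⟩
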